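/- **Setting.** Types are generated from the atomic types $\mathsf N$ (natural numbers), $\mathsf B$ (booleans) and possibly further atomic types by $\to$ and $\times$. Gödel's system $\mathsf T_0$ is the simply typed $\lambda$-calculus with pairs and projections over these types, with $0$, successor $\mathsf S$, $\mathsf{True}$, $\mathsf{False}$, conditionals $\mathsf{if}_T$ and primitive recursors $\mathsf R_T$ for all types $T$. A *simple extension* $\mathsf T$ of $\mathsf T_0$ adds a recursive set of new atomic types, a recursive set of constants of the new atomic types (without reduction rules), and a recursive set of constants $c:A_1\to\dots\to A_n\to A$ with all $A_i$ and $A$ atomic, together with a recursive set of rules consisting of exactly one rule $c\,a_1\dots a_n\mapsto a$ for each such $c$ and all closed normal terms $a_i:A_i$, where $a$ is a closed normal term of type $A$. (The closed normal terms of atomic type are the numerals $\mathsf S^n(0)$, the booleans, and the constants of the new atomic types. All the added sets may be empty.) Equality $t=u$ between terms is provable equality: the congruence, closed under all term formers including $\lambda$, generated by $\beta$, the projection rules, the rules of $\mathsf R_T$ and $\mathsf{if}_T$, and the added rules. For functions $g_1,g_2:\mathbb N\to\mathbb N$ put $g_1\le g_2$ iff, for all $n$, $g_1(n)\ne0$ implies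 $g_1(n)=g_2(n)$; for closed terms $t_1,t_2:\mathsf N\to\mathsf N$ put $t_1\le t_2$ iff the functions they represent are so related. A closed term $s:\mathsf N\to(\mathsf N\to\mathsf N)$ is *weakly increasing* if $s\,n\le s\,m$ for all numerals $n\le m$. A closed term $h:\mathsf N\to\mathsf N$ satisfies $h\ge\mathrm{id}$ if $h(x)\ge x$ for all numerals $x$. For a closed term $f:\mathsf N\to A$ with $A$ atomic, $f\downarrow[a,b]$ means that $f(x)=f(a)$ for all numerals $x$ with $a\le x\le b$. A closed term $\mathcal N:(\mathsf N\to\mathsf N)\to(\mathsf N\to\mathsf N)$ is a *modulus of convergence* for $f$ if for every closed term $h:\mathsf N\to\mathsf N$ with $h\ge\mathrm{id}$: 1. $\mathcal N h\ge\mathrm{id}$; 2. $f\downarrow[\mathcal N h\,z,\;h(\mathcal N h\,z)]$ for every numeral $z$. **Theorem (Weak Convergence Theorem for Collections of Terms).** Let $\mathsf T$ be a simple extension of Gödel's system $\mathsf T_0$. From every closed term $t:\mathsf N\to(\mathsf N\to\mathsf N)\to A$ of $\mathsf T$ with $A$ atomic one can effectively (that is, by a function computable on Gödel numbers of terms, in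 which bound variables and the constants $\mathsf R_T$, $\mathsf{if}_T$ carry their types) define a closed term $$\mathcal M:\mathsf N\to(\mathsf N\to(\mathsf N\to\mathsf N))\to(\mathsf N\to\mathsf N)\to(\mathsf N\to\mathsf N)$$ of $\mathsf T$ such that for every weakly increasing closed term $s:\mathsf N\to(\mathsf N\to\mathsf N)$ of $\mathsf T$ and every numeral $n$, $\mathcal M\,n\,s$ is a modulus of convergence for $\lambda m^{\mathsf N}.\,t\,n\,(s\,m)$. -/

import Mathlib

namespace SysT

/-- Atomic types: `nat`, `bool`, and the additional atomic types of the extension. -/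
inductive Base (α : Type) : Type
  | nat : Base α
  | bool : Base α
  | atom : α → Base α

/-- Types: generated from the atomic ones by `→` and `×`. -/
inductive Ty (α : Type) : Type
  | base : Base α → Ty α
  | arr : Ty α → Ty α → Ty α
  | prod : Ty α → Ty α → Ty α

namespace Ty

/-- The type of natural numbers. -/
abbrev N {α : Type} : Ty α := .base .nat

/-- The type of booleans. -/
abbrev B {α : Type} : Ty α := .base .bool

/-- `N → N`. -/
abbrev NN {α : Type} : Ty α := .arr N N

/-- `N → (N → N)`. -/
abbrev NNN {α : Type} : Ty α := .arr N NN

/-- `A₁ → … → Aₙ → A` for atomic `A₁, …, Aₙ, A`. -/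
def curried {α : Type} : List (Base α) → Base α → Ty α
  | [], A => .base A
  | A₁ :: As, A => .arr (.base A₁) (curried As A)

/-- Gödel numbers of types. -/
def code {α : Type} [Encodable α] : Ty α → ℕ
  | .base .nat => Nat.pair 1 0
  | .base .bool => Nat.pair 2 0
  | .base (.atom a) => Nat.pair 3 (Encodable.encode a)
  | .arr U V => Nat.pair 4 (Nat.pair U.code V.code)
  | .prod U V => Nat.pair 5 (Nat.pair U.code V.code)

end Ty

/-- The symbols that an extension adds to Gödel's system T, as recursive sets with a recursive type
assignment: atomic types `Atom`; constants `Data` of the new atomic types, which have no reduction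
rule; constants `Fn` of types `A₁ → … → Aₙ → A` with all `Aᵢ` and `A` atomic. All may be empty. -/
structure Signature where
  Atom : Type
  Data : Type
  Fn : Type
  [atomCodable : Primcodable Atom]
  [dataCodable : Primcodable Data]
  [fnCodable : Primcodable Fn]
  dataTy : Data → Atom
  args : Fn → List (Base Atom)
  res : Fn → Base Atom
  computable_dataTy : Computable dataTy
  computable_fnTy : Computable fun c => (Ty.curried (args c) (res c)).code

attribute [instance] Signature.atomCodable Signature.dataCodable Signature.fnCodable

section Signature

variable (S : Signature)

/-- Objects of atomic type, that is, the closed normal terms of that type: natural numbers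
(standing for numerals), booleans, and the constants of the new atomic types. -/
def Val : Base S.Atom → Type
  | .nat => ℕ
  | .bool => Bool
  | .atom a => {d : S.Data // S.dataTy d = a}

/-- Tuples of objects of given atomic types. -/
def Vals : List (Base S.Atom) → Type
  | [] => Unit
  | A :: As => Val S A × Vals As

variable {S}

/-- Gödel numbers of the objects of a given atomic type. -/
def Val.code : {A : Base S.Atom} → Val S A → ℕ
  | .nat, n => (n : ℕ)
  | .bool, b => Encodable.encode (α := Bool) b
  | .atom _, d => Encodable.encode (Subtype.val d)

/-- Gödel numbers of tuples of objects. -/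
def Vals.code : {As : List (Base S.Atom)} → Vals S As → ℕ
  | [], _ => 0
  | _ :: _, v => Nat.pair (Val.code v.1) (Vals.code v.2)

end Signature

/-- A simple extension of Gödel's system T: a signature with a recursive functional set of reduction
rules, exactly one rule `c a₁ … aₙ ↦ a` for each function constant `c` and all objects `aᵢ` of the
argument types, `a` being an object of the result type. -/
structure SimpleExtension extends Signature where
  rule : (c : Fn) → Vals toSignature (args c) → Val toSignature (res c)
  computable_rule : ∃ r : ℕ → ℕ → ℕ, Computable₂ r ∧
    ∀ (c : Fn) (v : Vals toSignature (args c)), r (Encodable.encode c) v.code = (rule c v).code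

/-- Typed variables as positions in a context (de Bruijn indices). -/
inductive Var {α : Type} : List (Ty α) → Ty α → Type
  | here {Γ : List (Ty α)} {T : Ty α} : Var (T :: Γ) T
  | there {Γ : List (Ty α)} {T U : Ty α} : Var Γ T → Var (U :: Γ) T

/-- The de Bruijn index as a number. -/
def Var.index {α : Type} : {Γ : List (Ty α)} → {T : Ty α} → Var Γ T → ℕ
  | _, _, .here => 0
  | _, _, .there x => x.index + 1

/-- Terms of type `T` whose free variables are declared in the context `Γ`. -/
inductive Tm (S : Signature) : List (Ty S.Atom) → Ty S.Atom → Type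
  | var {Γ : List (Ty S.Atom)} {T : Ty S.Atom} : Var Γ T → Tm S Γ T
  | zero {Γ : List (Ty S.Atom)} : Tm S Γ Ty.N
  | tt {Γ : List (Ty S.Atom)} : Tm S Γ Ty.B
  | ff {Γ : List (Ty S.Atom)} : Tm S Γ Ty.B
  | cond {Γ : List (Ty S.Atom)} (T : Ty S.Atom) : Tm S Γ (.arr Ty.B (.arr T (.arr T T)))
  | recur {Γ : List (Ty S.Atom)} (T : Ty S.Atom) :
      Tm S Γ (.arr T (.arr (.arr Ty.N (.arr T T)) (.arr Ty.N T)))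
  | suc {Γ : List (Ty S.Atom)} : Tm S Γ Ty.N → Tm S Γ Ty.N
  | app {Γ : List (Ty S.Atom)} {U V : Ty S.Atom} : Tm S Γ (.arr U V) → Tm S Γ U → Tm S Γ V
  | fst {Γ : List (Ty S.Atom)} {U V : Ty S.Atom} : Tm S Γ (.prod U V) → Tm S Γ U
  | snd {Γ : List (Ty S.Atom)} {U V : Ty S.Atom} : Tm S Γ (.prod U V) → Tm S Γ V
  | pair {Γ : List (Ty S.Atom)} {U V : Ty S.Atom} : Tm S Γ U → Tm S Γ V → Tm S Γ (.prod U V)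
  | lam {Γ : List (Ty S.Atom)} (U : Ty S.Atom) {V : Ty S.Atom} :
      Tm S (U :: Γ) V → Tm S Γ (.arr U V)
  | data {Γ : List (Ty S.Atom)} (d : S.Data) : Tm S Γ (.base (.atom (S.dataTy d)))
  | fn {Γ : List (Ty S.Atom)} (c : S.Fn) : Tm S Γ (Ty.curried (S.args c) (S.res c))

/-- Closed terms. -/
abbrev Closed (S : Signature) (T : Ty S.Atom) : Type := Tm S [] T

namespace Tm

variable {S : Signature}

/-- Gödel numbers of terms; bound variables and constants carry their types. -/
def code : {Γ : List (Ty S.Atom)} → {T : Ty S.Atom} → Tm S Γ T → ℕ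
  | _, _, .var x => Nat.pair 1 x.index
  | _, _, .zero => Nat.pair 2 0
  | _, _, .tt => Nat.pair 3 0
  | _, _, .ff => Nat.pair 4 0
  | _, _, .cond T => Nat.pair 5 T.code
  | _, _, .recur T => Nat.pair 6 T.code
  | _, _, .suc t => Nat.pair 7 t.code
  | _, _, .app t u => Nat.pair 8 (Nat.pair t.code u.code)
  | _, _, .fst t => Nat.pair 9 t.code
  | _, _, .snd t => Nat.pair 10 t.code
  | _, _, .pair t u => Nat.pair 11 (Nat.pair t.code u.code)
  | _, _, .lam U t => Nat.pair 12 (Nat.pair U.code t.code)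
  | _, _, .data d => Nat.pair 13 (Encodable.encode d)
  | _, _, .fn c => Nat.pair 14 (Encodable.encode c)

/-- Extend a renaming under a binder. -/
def liftRen {Γ Δ : List (Ty S.Atom)} {U : Ty S.Atom} (ρ : (T : Ty S.Atom) → Var Γ T → Var Δ T) :
    (T : Ty S.Atom) → Var (U :: Γ) T → Var (U :: Δ) T
  | _, .here => .here
  | T, .there x => .there (ρ T x)

/-- Renaming of free variables. -/
def rename : {Γ Δ : List (Ty S.Atom)} → {T : Ty S.Atom} →
    ((T : Ty S.Atom) → Var Γ T → Var Δ T) → Tm S Γ T → Tm S Δ T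
  | _, _, _, ρ, .var x => .var (ρ _ x)
  | _, _, _, _, .zero => .zero
  | _, _, _, _, .tt => .tt
  | _, _, _, _, .ff => .ff
  | _, _, _, _, .cond T => .cond T
  | _, _, _, _, .recur T => .recur T
  | _, _, _, ρ, .suc t => .suc (rename ρ t)
  | _, _, _, ρ, .app t u => .app (rename ρ t) (rename ρ u)
  | _, _, _, ρ, .fst t => .fst (rename ρ t)
  | _, _, _, ρ, .snd t => .snd (rename ρ t)
  | _, _, _, ρ, .pair t u => .pair (rename ρ t) (rename ρ u)
  | _, _, _, ρ, .lam U t => .lam U (rename (liftRen ρ) t)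
  | _, _, _, _, .data d => .data d
  | _, _, _, _, .fn c => .fn c

/-- Weakening by one fresh variable. -/
def weaken {Γ : List (Ty S.Atom)} {T U : Ty S.Atom} (t : Tm S Γ T) : Tm S (U :: Γ) T :=
  rename (fun _ x => .there x) t

/-- Extend a substitution under a binder. -/
def liftSub {Γ Δ : List (Ty S.Atom)} {U : Ty S.Atom} (σ : (T : Ty S.Atom) → Var Γ T → Tm S Δ T) :
    (T : Ty S.Atom) → Var (U :: Γ) T → Tm S (U :: Δ) T
  | _, .here => .var .here
  | T, .there x => weaken (σ T x)

/-- Simultaneous capture-avoiding substitution. -/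
def subst : {Γ Δ : List (Ty S.Atom)} → {T : Ty S.Atom} →
    ((T : Ty S.Atom) → Var Γ T → Tm S Δ T) → Tm S Γ T → Tm S Δ T
  | _, _, _, σ, .var x => σ _ x
  | _, _, _, _, .zero => .zero
  | _, _, _, _, .tt => .tt
  | _, _, _, _, .ff => .ff
  | _, _, _, _, .cond T => .cond T
  | _, _, _, _, .recur T => .recur T
  | _, _, _, σ, .suc t => .suc (subst σ t)
  | _, _, _, σ, .app t u => .app (subst σ t) (subst σ u)
  | _, _, _, σ, .fst t => .fst (subst σ t)
  | _, _, _, σ, .snd t => .snd (subst σ t)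
  | _, _, _, σ, .pair t u => .pair (subst σ t) (subst σ u)
  | _, _, _, σ, .lam U t => .lam U (subst (liftSub σ) t)
  | _, _, _, _, .data d => .data d
  | _, _, _, _, .fn c => .fn c

/-- The substitution that replaces the last declared variable by `u`. -/
def single {Γ : List (Ty S.Atom)} {U : Ty S.Atom} (u : Tm S Γ U) :
    (T : Ty S.Atom) → Var (U :: Γ) T → Tm S Γ T
  | _, .here => u
  | _, .there x => .var x

/-- `t[u/x]`, where `x` is the last declared variable. -/
def inst {Γ : List (Ty S.Atom)} {T U : Ty S.Atom} (t : Tm S (U :: Γ) T) (u : Tm S Γ U) :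
    Tm S Γ T :=
  subst (single u) t

/-- The numeral `Sⁿ(0)`. -/
def num {Γ : List (Ty S.Atom)} : ℕ → Tm S Γ Ty.N
  | 0 => .zero
  | n + 1 => .suc (num n)

/-- The closed normal term (in any context) that an object of atomic type stands for. -/
def ofVal {Γ : List (Ty S.Atom)} : {A : Base S.Atom} → Val S A → Tm S Γ (.base A)
  | .nat, n => num (n : ℕ)
  | .bool, b => match (b : Bool) with
    | true => .tt
    | false => .ff
  | .atom _, ⟨d, h⟩ => h ▸ Tm.data d

/-- `t a₁ … aₙ` for objects `aᵢ` of atomic types. -/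
def apps {Γ : List (Ty S.Atom)} {A : Base S.Atom} : {As : List (Base S.Atom)} →
    Tm S Γ (Ty.curried As A) → Vals S As → Tm S Γ (.base A)
  | [], t, _ => t
  | _ :: _, t, v => apps (.app t (ofVal v.1)) v.2

end Tm

open Tm in
/-- Provable equality `t = u` of the system. -/
inductive Eqv (S : SimpleExtension) : {Γ : List (Ty S.Atom)} → {T : Ty S.Atom} →
    Tm S.toSignature Γ T → Tm S.toSignature Γ T → Prop
  | refl {Γ : List (Ty S.Atom)} {T : Ty S.Atom} (t : Tm S.toSignature Γ T) : Eqv S t t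
  | symm {Γ : List (Ty S.Atom)} {T : Ty S.Atom} {t u : Tm S.toSignature Γ T} :
      Eqv S t u → Eqv S u t
  | trans {Γ : List (Ty S.Atom)} {T : Ty S.Atom} {t u v : Tm S.toSignature Γ T} :
      Eqv S t u → Eqv S u v → Eqv S t v
  | app {Γ : List (Ty S.Atom)} {U V : Ty S.Atom} {t t' : Tm S.toSignature Γ (.arr U V)}
      {u u' : Tm S.toSignature Γ U} : Eqv S t t' → Eqv S u u' → Eqv S (.app t u) (.app t' u')
  | pair {Γ : List (Ty S.Atom)} {U V : Ty S.Atom} {t t' : Tm S.toSignature Γ U}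
      {u u' : Tm S.toSignature Γ V} : Eqv S t t' → Eqv S u u' → Eqv S (.pair t u) (.pair t' u')
  | suc {Γ : List (Ty S.Atom)} {t t' : Tm S.toSignature Γ Ty.N} :
      Eqv S t t' → Eqv S (.suc t) (.suc t')
  | lam {Γ : List (Ty S.Atom)} {U V : Ty S.Atom} {t t' : Tm S.toSignature (U :: Γ) V} :
      Eqv S t t' → Eqv S (.lam U t) (.lam U t')
  | fst {Γ : List (Ty S.Atom)} {U V : Ty S.Atom} {t t' : Tm S.toSignature Γ (.prod U V)} :
      Eqv S t t' → Eqv S (.fst t) (.fst t')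
  | snd {Γ : List (Ty S.Atom)} {U V : Ty S.Atom} {t t' : Tm S.toSignature Γ (.prod U V)} :
      Eqv S t t' → Eqv S (.snd t) (.snd t')
  | beta {Γ : List (Ty S.Atom)} {U V : Ty S.Atom} (t : Tm S.toSignature (U :: Γ) V)
      (u : Tm S.toSignature Γ U) : Eqv S (.app (.lam U t) u) (inst t u)
  | fst_pair {Γ : List (Ty S.Atom)} {U V : Ty S.Atom} (t : Tm S.toSignature Γ U)
      (u : Tm S.toSignature Γ V) : Eqv S (.fst (.pair t u)) t
  | snd_pair {Γ : List (Ty S.Atom)} {U V : Ty S.Atom} (t : Tm S.toSignature Γ U)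
      (u : Tm S.toSignature Γ V) : Eqv S (.snd (.pair t u)) u
  | recur_zero {Γ : List (Ty S.Atom)} {T : Ty S.Atom} (u : Tm S.toSignature Γ T)
      (v : Tm S.toSignature Γ (.arr Ty.N (.arr T T))) :
      Eqv S (.app (.app (.app (.recur T) u) v) .zero) u
  | recur_suc {Γ : List (Ty S.Atom)} {T : Ty S.Atom} (u : Tm S.toSignature Γ T)
      (v : Tm S.toSignature Γ (.arr Ty.N (.arr T T))) (t : Tm S.toSignature Γ Ty.N) :
      Eqv S (.app (.app (.app (.recur T) u) v) (.suc t))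
        (.app (.app v t) (.app (.app (.app (.recur T) u) v) t))
  | cond_tt {Γ : List (Ty S.Atom)} {T : Ty S.Atom} (u v : Tm S.toSignature Γ T) :
      Eqv S (.app (.app (.app (.cond T) .tt) u) v) u
  | cond_ff {Γ : List (Ty S.Atom)} {T : Ty S.Atom} (u v : Tm S.toSignature Γ T) :
      Eqv S (.app (.app (.app (.cond T) .ff) u) v) v
  | rule {Γ : List (Ty S.Atom)} (c : S.Fn) (v : Vals S.toSignature (S.args c)) :
      Eqv S (apps (Γ := Γ) (.fn c) v) (ofVal (S.rule c v))

section Convergence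

variable (S : SimpleExtension)

/-- The closed term `f` of type `N → N` represents the function `g`. -/
def Represents (f : Closed S.toSignature Ty.NN) (g : ℕ → ℕ) : Prop :=
  ∀ n : ℕ, Eqv S (.app f (Tm.num n)) (Tm.num (g n))

/-- `f₁ ≤ f₂` for functions: `f₂` extends `f₁`, the value `0` meaning absence of information. -/
def FunLE (f₁ f₂ : ℕ → ℕ) : Prop := ∀ n : ℕ, f₁ n ≠ 0 → f₁ n = f₂ n

/-- `t₁ ≤ t₂` for closed terms: the represented functions satisfy this. -/
def TermLE (t₁ t₂ : Closed S.toSignature Ty.NN) : Prop :=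
  ∃ g₁ g₂ : ℕ → ℕ, Represents S t₁ g₁ ∧ Represents S t₂ g₂ ∧ FunLE g₁ g₂

/-- The closed term `s` represents a weakly increasing chain of functions. -/
def WeaklyIncreasing (s : Closed S.toSignature Ty.NNN) : Prop :=
  ∀ n m : ℕ, n ≤ m → TermLE S (.app s (Tm.num n)) (.app s (Tm.num m))

/-- `a ≥ id` for a closed term `a` of type `N → N`. -/
def GeId (a : Closed S.toSignature Ty.NN) : Prop :=
  ∀ x : ℕ, ∃ y : ℕ, Eqv S (.app a (Tm.num x)) (Tm.num y) ∧ x ≤ y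

/-- `f ↓ [u, v]`: `f` is constant on the interval between the values of `u` and `v`. -/
def ConstOn {A : Base S.Atom} (f : Closed S.toSignature (.arr Ty.N (.base A)))
    (u v : Closed S.toSignature Ty.N) : Prop :=
  ∃ a b : ℕ, Eqv S u (Tm.num a) ∧ Eqv S v (Tm.num b) ∧
    ∀ x : ℕ, a ≤ x → x ≤ b → Eqv S (.app f (Tm.num x)) (.app f (Tm.num a))

/-- `M` is a modulus of convergence for `f`. -/
def IsModulus {A : Base S.Atom} (M : Closed S.toSignature (.arr Ty.NN Ty.NN))
    (f : Closed S.toSignature (.arr Ty.N (.base A))) : Prop :=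
  (∀ h : Closed S.toSignature Ty.NN, GeId S h → GeId S (.app M h)) ∧
  ∀ h : Closed S.toSignature Ty.NN, GeId S h → ∀ z : ℕ,
    ConstOn S f (.app (.app M h) (Tm.num z)) (.app h (.app (.app M h) (Tm.num z)))

end Convergence

/-- The closed term `λ m. t n (s m)`. -/
def alongChain {S : Signature} {A : Base S.Atom}
    (t : Closed S (.arr Ty.N (.arr Ty.NN (.base A)))) (s : Closed S Ty.NNN) (n : ℕ) :
    Closed S (.arr Ty.N (.base A)) :=
  .lam Ty.N (.app (.app t.weaken (Tm.num n)) (.app s.weaken (.var .here)))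

end SysT

namespace SysT

/-! Every object of atomic type is replaced by a sequence of such objects paired with a modulus of
convergence, and `Ty.lim` carries this through all types. A logical relation `Tracks` links an
object of type `T.lim` with a sequence of objects of type `T`: at atomic types the object consists
of the sequence and a modulus for it, and at arrow types tracked arguments give tracked values,
index by index. The fundamental lemma `tracks_lim` shows that the translation of a term tracks the
term. Applied to `t`, the constant sequence `n` and the chain `m ↦ s m`, it yields an atomic object
whose second component is the desired modulus.

The crux is recursion up to a number that is itself only convergent. If `g i` tracks `γ i` for each
fixed `i`, and `k` converges, then `Tracks.collapse` tracks `m ↦ γ (k m) m`. At atomic types, the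
modulus of `k` is queried with a modified `h'`, so large that on the interval it returns, where `k`
has one value, the modulus of that single `γ i` still has room to find a subinterval good for `h`.

For a weakly increasing chain and fixed `i`, the sequence `m ↦ s m i` changes at most once, from `0`
to its final value, so inspecting `s (h z) i` decides between `z` and `h z`. A merely convergent
argument `i` is again handled by `collapse`.

All this takes place among closed terms modulo provable equality. Neither normalization nor
consistency is needed: were two distinct cases `0` and `n + 1` identified, all closed terms of each
type would be equal (`Cls.eq_of_num_eq`). Effectiveness holds because the translation is
compositional, hence a course-of-values recursion on Gödel numbers. -/

/-- There are no variables in the empty context. -/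
def Var.elim {α : Type} {T : Ty α} {C : Sort*} (x : Var [] T) : C := nomatch x

/-! ### Substitution calculus and closed terms in context -/

namespace Tm

section Substitution

variable {S : Signature}

theorem rename_rename {Γ Δ Θ : List (Ty S.Atom)} {T : Ty S.Atom}
    (ρ : (T : Ty S.Atom) → Var Γ T → Var Δ T) (ρ' : (T : Ty S.Atom) → Var Δ T → Var Θ T)
    (t : Tm S Γ T) : rename ρ' (rename ρ t) = rename (fun T x => ρ' T (ρ T x)) t := by
  induction t generalizing Δ Θ with
  | lam U t ih =>
    simp only [rename, ih]
    congr 2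
    funext T x
    cases x <;> rfl
  | _ => simp only [rename, *]

theorem subst_rename {Γ Δ Θ : List (Ty S.Atom)} {T : Ty S.Atom}
    (ρ : (T : Ty S.Atom) → Var Γ T → Var Δ T) (σ : (T : Ty S.Atom) → Var Δ T → Tm S Θ T)
    (t : Tm S Γ T) : subst σ (rename ρ t) = subst (fun T x => σ T (ρ T x)) t := by
  induction t generalizing Δ Θ with
  | lam U t ih =>
    simp only [rename, subst, ih]
    congr 2
    funext T x
    cases x <;> rfl
  | _ => simp only [rename, subst, *]

theorem rename_subst {Γ Δ Θ : List (Ty S.Atom)} {T : Ty S.Atom}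
    (σ : (T : Ty S.Atom) → Var Γ T → Tm S Δ T) (ρ : (T : Ty S.Atom) → Var Δ T → Var Θ T)
    (t : Tm S Γ T) : rename ρ (subst σ t) = subst (fun T x => rename ρ (σ T x)) t := by
  induction t generalizing Δ Θ with
  | lam U t ih =>
    simp only [rename, subst, ih]
    congr 2
    funext T x
    cases x with
    | here => rfl
    | there x => simp only [liftSub, weaken, rename_rename]; rfl
  | _ => simp only [rename, subst, *]

theorem subst_subst {Γ Δ Θ : List (Ty S.Atom)} {T : Ty S.Atom}
    (σ : (T : Ty S.Atom) → Var Γ T → Tm S Δ T) (τ : (T : Ty S.Atom) → Var Δ T → Tm S Θ T)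
    (t : Tm S Γ T) : subst τ (subst σ t) = subst (fun T x => subst τ (σ T x)) t := by
  induction t generalizing Δ Θ with
  | lam U t ih =>
    simp only [subst, ih]
    congr 2
    funext T x
    cases x with
    | here => rfl
    | there x => simp only [liftSub, weaken, subst_rename, rename_subst]
  | _ => simp only [subst, *]

theorem subst_var {Γ : List (Ty S.Atom)} {T : Ty S.Atom} (t : Tm S Γ T) :
    subst (fun _ x => .var x) t = t := by
  induction t with
  | lam U t ih =>
    simp only [subst]
    congr 1
    refine Eq.trans ?_ ih
    congr 1
    funext T x
    cases x <;> rfl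
  | _ => simp only [subst, *]

/-- A substitution into closed terms does not affect closed terms. -/
theorem subst_closed {T : Ty S.Atom} (σ : (T : Ty S.Atom) → Var [] T → Closed S T)
    (t : Closed S T) : subst σ t = t := by
  refine Eq.trans ?_ (subst_var t)
  congr 1
  funext T x
  cases x

theorem inst_weaken {Γ : List (Ty S.Atom)} {T U : Ty S.Atom} (t : Tm S Γ T) (u : Tm S Γ U) :
    inst t.weaken u = t := by
  rw [inst, weaken, subst_rename]
  exact subst_var t

/-- A closed term in an arbitrary context. -/
def cl {Γ : List (Ty S.Atom)} {T : Ty S.Atom} (t : Closed S T) : Tm S Γ T :=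
  rename (fun _ x => x.elim) t

theorem subst_cl {Γ : List (Ty S.Atom)} {T : Ty S.Atom}
    (σ : (T : Ty S.Atom) → Var Γ T → Closed S T) (t : Closed S T) : subst σ (cl t) = t := by
  rw [cl, subst_rename, subst_closed]

/-- Codes see indices but not contexts. Hence a closed term inserted into a translation contributes
one fixed number, whatever binders surround it. -/
theorem code_rename {Γ Δ : List (Ty S.Atom)} {T : Ty S.Atom}
    (ρ : (T : Ty S.Atom) → Var Γ T → Var Δ T) (hρ : ∀ T x, (ρ T x).index = x.index)
    (t : Tm S Γ T) : (rename ρ t).code = t.code := by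
  induction t generalizing Δ with
  | lam U t ih =>
    simp only [rename, code]
    rw [ih]
    intro T x
    cases x with
    | here => rfl
    | there x => simp [liftRen, Var.index, hρ]
  | _ => simp only [rename, code, implies_true, *]

@[simp]
theorem code_cl {Γ : List (Ty S.Atom)} {T : Ty S.Atom} (t : Closed S T) :
    (cl t : Tm S Γ T).code = t.code :=
  code_rename _ (fun _ x => x.elim) t

end Substitution

end Tm

/-! ### The model of closed terms modulo provable equality -/

section TermModel

variable (S : SimpleExtension)

/-- Provable equality as an equivalence relation on closed terms. -/
def eqvSetoid (T : Ty S.Atom) : Setoid (Closed S.toSignature T) where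
  r := Eqv S
  iseqv := ⟨.refl, .symm, .trans⟩

/-- Closed terms up to provable equality. -/
def Cls (T : Ty S.Atom) : Type := Quotient (eqvSetoid S T)

/-- Assignments of classes of closed terms to variables. -/
abbrev Env (Γ : List (Ty S.Atom)) : Type := (T : Ty S.Atom) → Var Γ T → Cls S T

variable {S}

namespace Cls

/-- The class of a closed term. -/
def mk {T : Ty S.Atom} (t : Closed S.toSignature T) : Cls S T := Quotient.mk _ t

theorem mk_eq_mk {T : Ty S.Atom} {t u : Closed S.toSignature T} : mk t = mk u ↔ Eqv S t u :=
  Quotient.eq (r := eqvSetoid S T)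

theorem mk_surjective {T : Ty S.Atom} (a : Cls S T) : ∃ t, mk t = a := Quotient.exists_rep a

/-- A closed term in a given class. -/
noncomputable def rep {T : Ty S.Atom} (a : Cls S T) : Closed S.toSignature T := Quotient.out a

@[simp]
theorem mk_rep {T : Ty S.Atom} (a : Cls S T) : mk a.rep = a := Quotient.out_eq a

/-- The class of an application. -/
def app {U V : Ty S.Atom} (a : Cls S (.arr U V)) (b : Cls S U) : Cls S V :=
  Quotient.map₂ Tm.app (fun _ _ h _ _ h' => Eqv.app h h') a b

/-- The class of a pair. -/
def pair {U V : Ty S.Atom} (a : Cls S U) (b : Cls S V) : Cls S (.prod U V) :=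
  Quotient.map₂ Tm.pair (fun _ _ h _ _ h' => Eqv.pair h h') a b

/-- The class of a first projection. -/
def fst {U V : Ty S.Atom} (a : Cls S (.prod U V)) : Cls S U :=
  Quotient.map Tm.fst (fun _ _ h => Eqv.fst h) a

/-- The class of a second projection. -/
def snd {U V : Ty S.Atom} (a : Cls S (.prod U V)) : Cls S V :=
  Quotient.map Tm.snd (fun _ _ h => Eqv.snd h) a

/-- The class of a successor. -/
def suc (a : Cls S Ty.N) : Cls S Ty.N := Quotient.map Tm.suc (fun _ _ h => Eqv.suc h) a

/-- The class of a numeral. -/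
def num (n : ℕ) : Cls S Ty.N := mk (Tm.num n)

/-- The class of the normal term for an object of atomic type. -/
def val {A : Base S.Atom} (v : Val S.toSignature A) : Cls S (.base A) := mk (Tm.ofVal v)

@[simp]
theorem fst_pair {U V : Ty S.Atom} (a : Cls S U) (b : Cls S V) : (pair a b).fst = a := by
  obtain ⟨t, rfl⟩ := mk_surjective a
  obtain ⟨u, rfl⟩ := mk_surjective b
  exact mk_eq_mk.2 (.fst_pair t u)

@[simp]
theorem snd_pair {U V : Ty S.Atom} (a : Cls S U) (b : Cls S V) : (pair a b).snd = b := by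
  obtain ⟨t, rfl⟩ := mk_surjective a
  obtain ⟨u, rfl⟩ := mk_surjective b
  exact mk_eq_mk.2 (.snd_pair t u)

@[simp]
theorem suc_num (n : ℕ) : (num n : Cls S Ty.N).suc = num (n + 1) := rfl

/-- The class of a recursor. -/
def recur (T : Ty S.Atom) : Cls S (.arr T (.arr (.arr Ty.N (.arr T T)) (.arr Ty.N T))) :=
  mk (.recur T)

/-- The class of a conditional. -/
def cond (T : Ty S.Atom) : Cls S (.arr Ty.B (.arr T (.arr T T))) := mk (.cond T)

@[simp]
theorem recur_zero {T : Ty S.Atom} (a : Cls S T) (b : Cls S (.arr Ty.N (.arr T T))) :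
    (((recur T).app a).app b).app (num 0) = a := by
  obtain ⟨t, rfl⟩ := mk_surjective a
  obtain ⟨u, rfl⟩ := mk_surjective b
  exact mk_eq_mk.2 (.recur_zero t u)

@[simp]
theorem recur_succ {T : Ty S.Atom} (a : Cls S T) (b : Cls S (.arr Ty.N (.arr T T))) (n : ℕ) :
    (((recur T).app a).app b).app (num (n + 1)) =
      (b.app (num n)).app ((((recur T).app a).app b).app (num n)) := by
  obtain ⟨t, rfl⟩ := mk_surjective a
  obtain ⟨u, rfl⟩ := mk_surjective b
  exact mk_eq_mk.2 (.recur_suc t u _)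

@[simp]
theorem cond_true {T : Ty S.Atom} (a b : Cls S T) :
    (((cond T).app (mk .tt)).app a).app b = a := by
  obtain ⟨t, rfl⟩ := mk_surjective a
  obtain ⟨u, rfl⟩ := mk_surjective b
  exact mk_eq_mk.2 (.cond_tt t u)

@[simp]
theorem cond_false {T : Ty S.Atom} (a b : Cls S T) :
    (((cond T).app (mk .ff)).app a).app b = b := by
  obtain ⟨t, rfl⟩ := mk_surjective a
  obtain ⟨u, rfl⟩ := mk_surjective b
  exact mk_eq_mk.2 (.cond_ff t u)

end Cls

/-- Extend an assignment to one more variable. -/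
def Env.cons {Γ : List (Ty S.Atom)} {U : Ty S.Atom} (e : Env S Γ) (a : Cls S U) :
    Env S (U :: Γ)
  | _, .here => a
  | T, .there x => e T x

@[simp]
theorem Env.cons_here {Γ : List (Ty S.Atom)} {U : Ty S.Atom} (e : Env S Γ) (a : Cls S U) :
    e.cons a U .here = a := rfl

@[simp]
theorem Env.cons_there {Γ : List (Ty S.Atom)} {T U : Ty S.Atom} (e : Env S Γ) (a : Cls S U)
    (x : Var Γ T) : e.cons a T (.there x) = e T x := rfl

/-- The empty assignment. -/
def Env.nil : Env S [] := fun _ x => x.elim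

/-- The class of a term under an assignment. -/
noncomputable def eval {Γ : List (Ty S.Atom)} {T : Ty S.Atom} (e : Env S Γ)
    (t : Tm S.toSignature Γ T) : Cls S T :=
  .mk (t.subst fun T x => (e T x).rep)

section Eval

variable {Γ : List (Ty S.Atom)} (e : Env S Γ)

@[simp]
theorem eval_var {T : Ty S.Atom} (x : Var Γ T) : eval e (.var x) = e T x := Cls.mk_rep _

@[simp]
theorem eval_zero : eval e .zero = .num 0 := rfl

@[simp]
theorem eval_cond (T : Ty S.Atom) : eval e (.cond T) = .cond T := rfl

@[simp]
theorem eval_recur (T : Ty S.Atom) : eval e (.recur T) = .recur T := rfl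

@[simp]
theorem eval_fn (c : S.Fn) : eval e (.fn c) = .mk (.fn c) := rfl

@[simp]
theorem eval_suc (t : Tm S.toSignature Γ Ty.N) : eval e (.suc t) = (eval e t).suc := rfl

@[simp]
theorem eval_app {U V : Ty S.Atom} (t : Tm S.toSignature Γ (.arr U V))
    (u : Tm S.toSignature Γ U) : eval e (.app t u) = (eval e t).app (eval e u) := rfl

@[simp]
theorem eval_pair {U V : Ty S.Atom} (t : Tm S.toSignature Γ U) (u : Tm S.toSignature Γ V) :
    eval e (.pair t u) = (eval e t).pair (eval e u) := rfl

@[simp]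
theorem eval_fst {U V : Ty S.Atom} (t : Tm S.toSignature Γ (.prod U V)) :
    eval e (.fst t) = (eval e t).fst := rfl

@[simp]
theorem eval_snd {U V : Ty S.Atom} (t : Tm S.toSignature Γ (.prod U V)) :
    eval e (.snd t) = (eval e t).snd := rfl

-- Applying β to the representative `a.rep` produces exactly the substitution that defines `eval`
-- for the extended assignment. With this rule `simp` computes applied terms, and the model needs no
-- operation for abstraction.
@[simp]
theorem eval_lam_app {U V : Ty S.Atom} (t : Tm S.toSignature (U :: Γ) V) (a : Cls S U) :
    (eval e (.lam U t)).app a = eval (e.cons a) t := by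
  conv_lhs => rw [← Cls.mk_rep a]
  refine (Cls.mk_eq_mk.2 (.beta _ a.rep)).trans ?_
  rw [eval, Tm.inst, Tm.subst_subst]
  congr 2
  funext T x
  cases x with
  | here => rfl
  | there x => exact Tm.inst_weaken _ _

@[simp]
theorem eval_cl {T : Ty S.Atom} (t : Closed S.toSignature T) : eval e (Tm.cl t) = .mk t := by
  rw [eval, Tm.subst_cl]

theorem mk_eq_eval {T : Ty S.Atom} (t : Closed S.toSignature T) : Cls.mk t = eval Env.nil t := by
  rw [eval, Tm.subst_closed]

end Eval

/-- If two numerals `0` and `n + 1` were provably equal, then all closed terms would be. -/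
theorem Cls.eq_of_num_eq {n : ℕ} (h : (num 0 : Cls S Ty.N) = num (n + 1)) {T : Ty S.Atom}
    (a b : Cls S T) : a = b := by
  -- A recursor that starts at `a` and steps constantly to `b` separates `0` from every successor.
  let k : Cls S (.arr Ty.N (.arr T T)) :=
    eval (Env.nil.cons b) (.lam Ty.N (.lam T (.var (.there (.there .here)))))
  calc a = (((recur T).app a).app k).app (num 0) := by simp
    _ = (((recur T).app a).app k).app (num (n + 1)) := by rw [h]
    _ = b := by simp [k]

end TermModel

/-! ### Translation of types and terms to convergent objects -/

namespace Ty

/-- The type of moduli of convergence. -/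
abbrev Modulus {α : Type} : Ty α := .arr NN NN

/-- Sequences of atomic objects together with a modulus of convergence replace the objects of
atomic type. -/
@[reducible]
def lim {α : Type} : Ty α → Ty α
  | .base A => .prod (.arr N (.base A)) Modulus
  | .arr U V => .arr U.lim V.lim
  | .prod U V => .prod U.lim V.lim

end Ty

/-- The variable corresponding to a given one after translation of all types. -/
def Var.lim {α : Type} : {Γ : List (Ty α)} → {T : Ty α} → Var Γ T → Var (Γ.map Ty.lim) T.lim
  | _, _, .here => .here
  | _, _, .there x => .there x.lim

theorem Var.index_lim {α : Type} {Γ : List (Ty α)} {T : Ty α} (x : Var Γ T) :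
    x.lim.index = x.index := by
  induction x with
  | here => rfl
  | there x ih => exact congrArg (· + 1) ih

namespace Tm

variable {S : Signature}

/-- The last declared variable. -/
abbrev v0 {Γ : List (Ty S.Atom)} {T : Ty S.Atom} : Tm S (T :: Γ) T := .var .here

/-- The last but one declared variable. -/
abbrev v1 {Γ : List (Ty S.Atom)} {T U : Ty S.Atom} : Tm S (U :: T :: Γ) T := .var (.there .here)

/-- The third variable from the end. -/
abbrev v2 {Γ : List (Ty S.Atom)} {T U V : Ty S.Atom} : Tm S (V :: U :: T :: Γ) T :=
  .var (.there (.there .here))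

/-- The fourth variable from the end. -/
abbrev v3 {Γ : List (Ty S.Atom)} {T U V W : Ty S.Atom} : Tm S (W :: V :: U :: T :: Γ) T :=
  .var (.there (.there (.there .here)))

/-- The fifth variable from the end. -/
abbrev v4 {Γ : List (Ty S.Atom)} {T U V W X : Ty S.Atom} : Tm S (X :: W :: V :: U :: T :: Γ) T :=
  .var (.there (.there (.there (.there .here))))

/-- The modulus of convergence of a constant sequence. -/
def idModulus : Closed S Ty.Modulus := .lam Ty.NN (.lam Ty.N v0)

/-- A common modulus of convergence for two sequences. -/
def joinModulus : Closed S (.arr Ty.Modulus (.arr Ty.Modulus Ty.Modulus)) :=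
  .lam Ty.Modulus (.lam Ty.Modulus (.lam Ty.NN (.lam Ty.N
    (.app (.app v2 v1) (.app (.app v3 (.lam Ty.N (.app v2 (.app (.app v3 v2) v0)))) v0)))))

/-- The sequence with a given constant value and its modulus. -/
def constSeq : Closed S (.arr Ty.N Ty.N.lim) :=
  .lam Ty.N (.pair (.lam Ty.N v1) (cl idModulus))

/-- Evaluation of a sequence of convergent objects at a convergent number. -/
def collapse : (T : Ty S.Atom) → Closed S (.arr (.arr Ty.N T.lim) (.arr Ty.N.lim T.lim))
  | .base A => .lam (.arr Ty.N (Ty.base A).lim) (.lam Ty.N.lim (.pair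
      (.lam Ty.N (.app (.fst (.app v2 (.app (.fst v1) v0))) v0))
      (.lam Ty.NN (.lam Ty.N (.app
        (.lam Ty.N (.app (.app (.snd (.app v4 (.app (.fst v3) v0))) v2) v0))
        (.app (.app (.snd v2)
          (.lam Ty.N (.app v2 (.app (.app (.snd (.app v4 (.app (.fst v3) v0))) v2) v0)))) v0))))))
  | .arr U V => .lam (.arr Ty.N (Ty.arr U V).lim) (.lam Ty.N.lim (.lam U.lim
      (.app (.app (cl (collapse V)) (.lam Ty.N (.app (.app v3 v0) v1))) v1)))
  | .prod U V => .lam (.arr Ty.N (Ty.prod U V).lim) (.lam Ty.N.lim (.pair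
      (.app (.app (cl (collapse U)) (.lam Ty.N (.fst (.app v2 v0)))) v0)
      (.app (.app (cl (collapse V)) (.lam Ty.N (.snd (.app v2 v0)))) v0)))

/-- The translation of the successor. -/
def limSuc : Closed S (.arr Ty.N.lim Ty.N.lim) :=
  .lam Ty.N.lim (.pair (.lam Ty.N (.suc (.app (.fst v1) v0))) (.snd v0))

/-- The translation of a recursor. -/
def limRecur (T : Ty S.Atom) :
    Closed S (.arr T.lim (.arr (.arr Ty.N.lim (.arr T.lim T.lim)) (.arr Ty.N.lim T.lim))) :=
  .lam T.lim (.lam (.arr Ty.N.lim (.arr T.lim T.lim)) (.app (cl (collapse T))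
    (.app (.app (.recur T.lim) v1) (.lam Ty.N (.app v1 (.app (cl constSeq) v0))))))

/-- The translation of a conditional. -/
def limCond (T : Ty S.Atom) : Closed S (.arr Ty.B.lim (.arr T.lim (.arr T.lim T.lim))) :=
  .lam Ty.B.lim (.lam T.lim (.lam T.lim (.app
    (.app (cl (collapse T)) (.app (.app (.recur T.lim) v1) (.lam Ty.N (.lam T.lim v2))))
    (.pair (.lam Ty.N (.app (.app (.app (.cond Ty.N) (.app (.fst v3) v0)) .zero) (.suc .zero)))
      (.snd v2)))))

/-- The translation of a constant of atomic type. -/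
def limFnNil (A : Base S.Atom) :
    Closed S (.arr (.arr Ty.N (.base A)) (.arr Ty.Modulus (Ty.base A).lim)) :=
  .lam (.arr Ty.N (.base A)) (.lam Ty.Modulus (.pair v1 v0))

/-- The translation of a constant with one more argument. -/
def limFnCons (B : Base S.Atom) (T : Ty S.Atom) :
    Closed S (.arr (.arr (.arr Ty.N T) (.arr Ty.Modulus T.lim))
      (.arr (.arr Ty.N (.arr (.base B) T)) (.arr Ty.Modulus (.arr (Ty.base B).lim T.lim)))) :=
  .lam (.arr (.arr Ty.N T) (.arr Ty.Modulus T.lim)) (.lam (.arr Ty.N (.arr (.base B) T))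
    (.lam Ty.Modulus (.lam (Ty.base B).lim
      (.app (.app v3 (.lam Ty.N (.app (.app v3 v0) (.app (.fst v1) v0))))
        (.app (.app (cl joinModulus) v1) (.snd v0))))))

/-- The translation of function constants: it accumulates the modulus of convergence of the
arguments. -/
def limFn (A : Base S.Atom) : (As : List (Base S.Atom)) →
    Closed S (.arr (.arr Ty.N (Ty.curried As A)) (.arr Ty.Modulus (Ty.curried As A).lim))
  | [] => limFnNil A
  | B :: Bs => .app (limFnCons B (Ty.curried Bs A)) (limFn A Bs)

/-- The convergent function along a weakly increasing chain of functions. -/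
def limChain : Closed S (.arr Ty.NNN Ty.NN.lim) :=
  .lam Ty.NNN (.app (cl (collapse Ty.N)) (.lam Ty.N (.pair (.lam Ty.N (.app (.app v2 v0) v1))
    (.lam Ty.NN (.lam Ty.N (.app (.app (.app (.recur Ty.N) v0)
      (.lam Ty.N (.lam Ty.N (.app v3 v2)))) (.app (.app v3 (.app v1 v0)) v2)))))))

/-- The translation of terms. -/
def lim : {Γ : List (Ty S.Atom)} → {T : Ty S.Atom} → Tm S Γ T → Tm S (Γ.map Ty.lim) T.lim
  | _, _, .var x => .var x.lim
  | _, _, .zero => .pair (.lam Ty.N .zero) (cl idModulus)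
  | _, _, .tt => .pair (.lam Ty.N .tt) (cl idModulus)
  | _, _, .ff => .pair (.lam Ty.N .ff) (cl idModulus)
  | _, _, .cond T => cl (limCond T)
  | _, _, .recur T => cl (limRecur T)
  | _, _, .suc t => .app (cl limSuc) t.lim
  | _, _, .app t u => .app t.lim u.lim
  | _, _, .fst t => .fst t.lim
  | _, _, .snd t => .snd t.lim
  | _, _, .pair t u => .pair t.lim u.lim
  | _, _, .lam U t => .lam U.lim t.lim
  | _, _, .data d => .pair (.lam Ty.N (.data d)) (cl idModulus)
  | _, _, .fn c => .app (.app (cl (limFn (S.res c) (S.args c))) (.lam Ty.N (.fn c))) (cl idModulus)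

/-- The modulus of convergence of `λ m. t n (s m)`, as a function of `n` and `s`. -/
def modulus {A : Base S.Atom} (t : Closed S (.arr Ty.N (.arr Ty.NN (.base A)))) :
    Closed S (.arr Ty.N (.arr Ty.NNN Ty.Modulus)) :=
  .lam Ty.N (.lam Ty.NNN
    (.snd (.app (.app (cl t.lim) (.app (cl constSeq) v1)) (.app (cl limChain) v0))))

end Tm

/-! ### Moduli of convergence in the term model -/

section Tracking

open Cls

variable {S : SimpleExtension}

/-- `h` represents a function with `h x ≥ x` for all `x`. -/
def Cls.GeId (h : Cls S Ty.NN) : Prop := ∀ x, ∃ y, h.app (num x) = num y ∧ x ≤ y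

/-- `M` is a modulus of convergence for the sequence `f`. -/
def Cls.Controls {β : Type} (M : Cls S Ty.Modulus) (f : ℕ → β) : Prop :=
  ∀ h : Cls S Ty.NN, h.GeId → ∀ z, ∃ a, z ≤ a ∧ (M.app h).app (num z) = num a ∧
    ∀ b, h.app (num a) = num b → ∀ x, a ≤ x → x ≤ b → f x = f a

@[simp]
theorem Cls.idModulus_app (h : Cls S Ty.NN) (z : Cls S Ty.N) :
    ((mk Tm.idModulus).app h).app z = z := by
  rw [mk_eq_eval]
  simp [Tm.idModulus]

theorem Cls.controls_idModulus {β : Type} (b : β) :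
    Controls (S := S) (mk Tm.idModulus) fun _ => b :=
  fun _ _ z => ⟨z, le_rfl, by simp, fun _ _ _ _ _ => rfl⟩

/-- With `h' x = h (N h x)`, let `a = M h' z` and `c = N h a`. Then `g` is constant on `[c, h c]`,
and `f` is constant on `[a, h' a]`, which contains `[c, h c]` because `a ≤ c` and `h' a = h c`. -/
theorem Cls.Controls.join {β γ δ : Type} {M N : Cls S Ty.Modulus} {f : ℕ → β} {g : ℕ → γ}
    (hM : M.Controls f) (hN : N.Controls g) (k : β → γ → δ) :
    Controls (((mk Tm.joinModulus).app M).app N) fun m => k (f m) (g m) := by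
  intro h hh z
  let h' : Cls S Ty.NN := eval ((((Env.nil.cons M).cons N).cons h).cons (num z))
    (.lam Ty.N (.app Tm.v2 (.app (.app Tm.v3 Tm.v2) Tm.v0)))
  have hh' : ∀ x, h'.app x = h.app ((N.app h).app x) := fun x => by simp [h']
  have hid : h'.GeId := by
    intro x
    obtain ⟨a, hxa, ha, -⟩ := hN h hh x
    obtain ⟨b, hb, hab⟩ := hh a
    exact ⟨b, by rw [hh', ha, hb], hxa.trans hab⟩
  obtain ⟨a, hza, ha, hf⟩ := hM h' hid z
  obtain ⟨c, hac, hc, hg⟩ := hN h hh a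
  refine ⟨c, hza.trans hac, ?_, fun b hb x hcx hxb => ?_⟩
  · rw [← hc, ← ha, mk_eq_eval]
    simp [Tm.joinModulus, h']
  · have hb' : h'.app (num a) = num b := by rw [hh', hc, hb]
    simp only [hg b hb x hcx hxb, hf b hb' x (hac.trans hcx) hxb,
      hf b hb' c hac (hcx.trans hxb)]

@[simp]
theorem Cls.fst_collapse_base_app {A : Base S.Atom} (g : Cls S (.arr Ty.N (Ty.base A).lim))
    (x : Cls S Ty.N.lim) (m : Cls S Ty.N) :
    (((mk (Tm.collapse (.base A))).app g).app x).fst.app m =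
      (g.app (x.fst.app m)).fst.app m := by
  rw [mk_eq_eval]
  simp [Tm.collapse]

/-- As for `Controls.join`, but the second modulus depends on the value of `x`. Put `h' y = h (M y h
y)`, where `M y` is the modulus belonging to the `y`-th term of `x`. The modulus of `x` gives `a`
such that `x` is constant on `[a, h' a]`, so the single modulus `M a` serves there. With `c = M a h
a`, the interval `[c, h c]` lies inside, since `h c = h' a`. -/
theorem Cls.Controls.collapse {β : Type} {A : Base S.Atom}
    {g : Cls S (.arr Ty.N (Ty.base A).lim)} {x : Cls S Ty.N.lim} {f : Cls S Ty.N → ℕ → β}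
    (hx : x.snd.Controls fun m => x.fst.app (num m))
    (hg : ∀ m, (g.app (x.fst.app (num m))).snd.Controls (f (x.fst.app (num m)))) :
    Controls (((mk (Tm.collapse (.base A))).app g).app x).snd fun m => f (x.fst.app (num m)) m := by
  intro h hh z
  let h' : Cls S Ty.NN := eval ((((Env.nil.cons g).cons x).cons h).cons (num z))
    (.lam Ty.N (.app Tm.v2 (.app (.app (.snd (.app Tm.v4 (.app (.fst Tm.v3) Tm.v0))) Tm.v2) Tm.v0)))
  have hh' : ∀ y, h'.app y = h.app (((g.app (x.fst.app y)).snd.app h).app y) :=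
    fun x => by simp [h']
  have hid : h'.GeId := by
    intro y
    obtain ⟨a, hya, ha, -⟩ := hg y h hh y
    obtain ⟨b, hb, hab⟩ := hh a
    exact ⟨b, by rw [hh', ha, hb], hya.trans hab⟩
  obtain ⟨a, hza, ha, hf⟩ := hx h' hid z
  obtain ⟨c, hac, hc, hg⟩ := hg a h hh a
  refine ⟨c, hza.trans hac, ?_, fun b hb y hcy hyb => ?_⟩
  · rw [← hc, ← ha, mk_eq_eval]
    simp [Tm.collapse, h']
  · have hb' : h'.app (num a) = num b := by rw [hh', hc, hb]
    simp only [hf b hb' y (hac.trans hcy) hyb, hf b hb' c hac (hcy.trans hyb), hg b hb y hcy hyb]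

/-! ### The logical relation and the translated constants -/

/-- The object `x` of the translated type describes the sequence `α` of objects of type `T`;
at atomic types, it consists of the sequence and a modulus of convergence. -/
def Tracks : (T : Ty S.Atom) → Cls S T.lim → (ℕ → Cls S T) → Prop
  | .base _, x, α => (∀ m, x.fst.app (num m) = α m) ∧ (∀ m, ∃ v, α m = val v) ∧ x.snd.Controls α
  | .arr U V, x, α => ∀ (y : Cls S U.lim) (β : ℕ → Cls S U), Tracks U y β →
    Tracks V (x.app y) fun m => (α m).app (β m)
  | .prod U V, x, α => Tracks U x.fst (fun m => (α m).fst) ∧ Tracks V x.snd fun m => (α m).snd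

theorem Tracks.const {A : Base S.Atom} {Γ : List (Ty S.Atom)} (e : Env S Γ)
    (t : Tm S.toSignature (Ty.N :: Γ) (.base A)) {a : Cls S (.base A)}
    (h : ∀ m, eval (e.cons m) t = a) {v : Val S.toSignature A} (hv : a = val v) :
    Tracks (.base A) (eval e (.pair (.lam Ty.N t) (Tm.cl Tm.idModulus))) fun _ => a := by
  refine ⟨fun m => ?_, fun _ => ⟨v, hv⟩, ?_⟩
  · simp [h]
  · simpa using controls_idModulus a

theorem Tracks.constSeq (n : ℕ) :
    Tracks (S := S) Ty.N ((mk Tm.constSeq).app (num n)) fun _ => num n := by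
  rw [mk_eq_eval, Tm.constSeq, eval_lam_app]
  exact .const _ _ (fun m => by simp) (v := (n : ℕ)) rfl

/-- Only atomic types carry content. At arrows and products, the argument or the projection moves
under the index, as in `collapse g x y = collapse (fun i => g i y) x`, and the induction hypothesis
applies to the new family. -/
theorem Tracks.collapse {T : Ty S.Atom} {g : Cls S (.arr Ty.N T.lim)} {γ : ℕ → ℕ → Cls S T}
    {x : Cls S Ty.N.lim} {k : ℕ → ℕ} (hg : ∀ i, Tracks T (g.app (num i)) (γ i))
    (hx : Tracks Ty.N x fun m => num (k m)) :
    Tracks T (((mk (Tm.collapse T)).app g).app x) fun m => γ (k m) m := by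
  induction T with
  | base A =>
    -- Tracking at an atomic type forces `γ`. Read off from `g`, it is also defined on classes of
    -- terms rather than only on natural numbers, as `Controls.collapse` requires.
    obtain rfl : γ = fun i m => (g.app (num i)).fst.app (num m) :=
      funext₂ fun i m => ((hg i).1 m).symm
    refine ⟨fun m => ?_, fun m => (hg _).2.1 m, ?_⟩
    · rw [Cls.fst_collapse_base_app, hx.1 m]
    · have := Controls.collapse (g := g) (x := x) (f := fun n m => (g.app n).fst.app (num m))
        (by simpa only [hx.1] using hx.2.2) (fun m => by rw [hx.1]; exact (hg (k m)).2.2)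
      simpa only [hx.1] using this
  | arr U V ihU ihV =>
    intro y β hy
    have := ihV (g := eval (((Env.nil.cons g).cons x).cons y)
        (.lam Ty.N (.app (.app Tm.v3 Tm.v0) Tm.v1)))
      (γ := fun i m => (γ i m).app (β m)) (fun i => by simpa using hg i y β hy)
    convert this using 1
    rw [mk_eq_eval]
    simp [Tm.collapse]
  | prod U V ihU ihV =>
    constructor
    · have := ihU (g := eval ((Env.nil.cons g).cons x) (.lam Ty.N (.fst (.app Tm.v2 Tm.v0))))
        (γ := fun i m => (γ i m).fst) (fun i => by simpa using (hg i).1)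
      convert this using 1
      rw [mk_eq_eval]
      simp [Tm.collapse]
    · have := ihV (g := eval ((Env.nil.cons g).cons x) (.lam Ty.N (.snd (.app Tm.v2 Tm.v0))))
        (γ := fun i m => (γ i m).snd) (fun i => by simpa using (hg i).2)
      convert this using 1
      rw [mk_eq_eval]
      simp [Tm.collapse]

theorem Tracks.exists_num {x : Cls S Ty.N.lim} {α : ℕ → Cls S Ty.N} (h : Tracks Ty.N x α) :
    ∃ k : ℕ → ℕ, α = fun m => num (k m) := by
  choose k hk using h.2.1
  exact ⟨k, funext hk⟩

/-- Successor is a term former, so its abstraction is tracked. The modulus is kept, since successor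
respects equality. -/
theorem tracks_limSuc : Tracks (S := S) (.arr Ty.N Ty.N) (mk Tm.limSuc)
    fun _ => eval Env.nil (.lam Ty.N (.suc .v0)) := by
  intro x α hx
  obtain ⟨k, rfl⟩ := hx.exists_num
  rw [mk_eq_eval, Tm.limSuc]
  refine ⟨fun m => ?_, fun m => ⟨((k m + 1 : ℕ) : ℕ), ?_⟩, ?_⟩
  · simp [hx.1]
  · simp only [eval_lam_app, eval_suc, eval_var, Env.cons_here, suc_num]
    rfl
  · intro h hh z
    obtain ⟨a, hza, ha, hf⟩ := hx.2.2 h hh z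
    exact ⟨a, hza, by simp [ha], fun b hb y hy hyb => by simp [hf b hb y hy hyb]⟩

/-- For a fixed numeral `i`, ordinary induction on `i` shows that the recursion in the translated
types is tracked; the step function receives `i` as a constant sequence. `Tracks.collapse` then
replaces `i` by the convergent number. -/
theorem tracks_limRecur (T : Ty S.Atom) :
    Tracks (S := S) (.arr T (.arr (.arr Ty.N (.arr T T)) (.arr Ty.N T))) (mk (Tm.limRecur T))
      fun _ => recur T := by
  intro u α hu v β hv x κ hx
  obtain ⟨k, rfl⟩ := hx.exists_num
  let g : Cls S (.arr Ty.N T.lim) := eval ((Env.nil.cons u).cons v)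
    (.app (.app (.recur T.lim) .v1) (.lam Ty.N (.app .v1 (.app (.cl .constSeq) .v0))))
  have hg : ∀ i, Tracks T (g.app (num i))
      fun m => (((recur T).app (α m)).app (β m)).app (num i) := by
    intro i
    induction i with
    | zero => simpa [g] using hu
    | succ i ih =>
      have := hv _ _ (.constSeq i) _ _ ih
      simpa [g] using this
  convert Tracks.collapse hg hx using 1
  rw [mk_eq_eval]
  simp [Tm.limRecur, g]

/-- The boolean is turned into a convergent number, `0` for true and `1` for false, so that choosing
a branch becomes an instance of `collapse` for the family with value `u` at `0` and `v` at all
successors. -/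
theorem tracks_limCond (T : Ty S.Atom) :
    Tracks (S := S) (.arr Ty.B (.arr T (.arr T T))) (mk (Tm.limCond T)) fun _ => cond T := by
  intro b β hb u α hu v α' hv
  have hβ : ∀ m, ∃ c : Bool, β m = mk (bif c then .tt else .ff) := fun m => by
    obtain ⟨v, hv⟩ := hb.2.1 m
    refine ⟨v, hv.trans ?_⟩
    cases v <;> rfl
  choose c hc using hβ
  obtain rfl := funext hc
  let g : Cls S (.arr Ty.N T.lim) := eval (((Env.nil.cons b).cons u).cons v)
    (.app (.app (.recur T.lim) .v1) (.lam Ty.N (.lam T.lim .v2)))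
  let x : Cls S Ty.N.lim := eval (((Env.nil.cons b).cons u).cons v)
    (.pair (.lam Ty.N (.app (.app (.app (.cond Ty.N) (.app (.fst .v3) .v0)) .zero) (.suc .zero)))
      (.snd .v2))
  have hg : ∀ i, Tracks T (g.app (num i)) (Nat.casesOn i α fun _ => α') := by
    intro i
    cases i with
    | zero => simpa [g] using hu
    | succ i => simpa [g] using hv
  have hx : Tracks Ty.N x fun m => num (bif c m then 0 else 1) := by
    refine ⟨fun m => ?_, fun m => ⟨(bif c m then 0 else 1 : ℕ), rfl⟩, fun h hh z => ?_⟩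
    · simp only [x, eval_pair, fst_pair, eval_lam_app, eval_app, eval_cond, eval_fst, eval_var,
        Env.cons_here, Env.cons_there, hb.1]
      cases c m <;> simp
    · obtain ⟨a, hza, ha, hf⟩ := hb.2.2 h hh z
      refine ⟨a, hza, by simp [x, ha], fun i hi y hy hyi => ?_⟩
      -- Constancy is known for the classes of the booleans, not for `c`, and distinct booleans are
      -- not known to have distinct classes. The numbers are therefore written as functions of those
      -- classes.
      have key : ∀ m, num (bif c m then 0 else 1) =
          (((cond Ty.N).app (mk (bif c m then .tt else .ff))).app (num (S := S) 0)).app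
            (num 1) := fun m => by cases c m <;> simp
      simp only [key, hf i hi y hy hyi]
  convert Tracks.collapse hg hx using 1
  · rw [mk_eq_eval]
    simp [Tm.limCond, g, x]
  · funext m
    cases h : c m <;> simp [h]

theorem Cls.limFnNil_app {A : Base S.Atom} (g : Cls S (.arr Ty.N (.base A)))
    (M : Cls S Ty.Modulus) : ((mk (Tm.limFnNil A)).app g).app M = pair g M := by
  rw [mk_eq_eval]
  simp [Tm.limFnNil]

/-- A sequence of functions controlled by `M` is fed one argument at a time. Each argument sequence
is applied pointwise and its modulus is joined to `M`; when no argument remains, sequence and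
modulus form the atomic object. The hypothesis `hg` supplies the atomic normal values demanded at
that point. -/
theorem Tracks.limFn {A : Base S.Atom} {As : List (Base S.Atom)}
    {g : Cls S (.arr Ty.N (Ty.curried As A))} {M : Cls S Ty.Modulus}
    (hg : ∀ m v, ∃ t w, g.app (num m) = mk t ∧ mk (Tm.apps t v) = val w)
    (hM : M.Controls fun m => g.app (num m)) :
    Tracks (Ty.curried As A) (((mk (Tm.limFn A As)).app g).app M) fun m => g.app (num m) := by
  induction As generalizing M with
  | nil =>
    change Cls S (.arr Ty.N (.base A)) at g
    have key : Tracks (.base A) (((mk (Tm.limFnNil A)).app g).app M) fun m => g.app (num m) := by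
      rw [limFnNil_app]
      refine ⟨fun m => by simp, fun m => ?_, by rw [snd_pair]; exact hM⟩
      obtain ⟨t, w, h, h'⟩ := hg m ()
      exact ⟨w, h.trans h'⟩
    exact key
  | cons B Bs ih =>
    intro y β hy
    choose b hb using hy.2.1
    obtain rfl := funext hb
    change Cls S (.arr Ty.N (.arr (.base B) (Ty.curried Bs A))) at g
    let e : Env S [(Ty.base B).lim, Ty.Modulus, Ty.arr Ty.N (.arr (.base B) (Ty.curried Bs A)),
        .arr (.arr Ty.N (Ty.curried Bs A)) (.arr Ty.Modulus (Ty.curried Bs A).lim)] :=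
      (((Env.nil.cons (mk (Tm.limFn A Bs))).cons g).cons M).cons y
    let g' : Cls S (.arr Ty.N (Ty.curried Bs A)) :=
      eval e (.lam Ty.N (.app (.app .v3 .v0) (.app (.fst .v1) .v0)))
    have hg' : ∀ m, g'.app (num m) = (g.app (num m)).app (val (b m)) := fun m => by
      simp [g', e, hy.1]
    have := ih (g := g') (M := ((mk Tm.joinModulus).app M).app y.snd) (fun m v => ?_) ?_
    · simp only [hg'] at this
      have key : ((((mk (Tm.limFnCons B (Ty.curried Bs A))).app (mk (Tm.limFn A Bs))).app g).app
          M).app y = ((mk (Tm.limFn A Bs)).app g').app (((mk Tm.joinModulus).app M).app y.snd) := by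
        rw [mk_eq_eval (Tm.limFnCons _ _)]
        simp [Tm.limFnCons, g', e]
      rw [← key] at this
      exact this
    · obtain ⟨t, w, h, h'⟩ := hg m (b m, v)
      exact ⟨.app t (.ofVal (b m)), w, (hg' m).trans
        (congrArg (fun f : Cls S (.arr (.base B) (Ty.curried Bs A)) => f.app (val (b m))) h), h'⟩
    · simp only [hg']
      exact hM.join hy.2.2 app

/-- The fundamental lemma of the logical relation. The assignment `ε` depends on the index `m`
because under a binder the new variable stands for a whole sequence. -/
theorem tracks_lim {Γ : List (Ty S.Atom)} {T : Ty S.Atom} (t : Tm S.toSignature Γ T)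
    (e : Env S (Γ.map Ty.lim)) (ε : ℕ → Env S Γ)
    (he : ∀ T (x : Var Γ T), Tracks T (e T.lim x.lim) fun m => ε m T x) :
    Tracks T (eval e t.lim) fun m => eval (ε m) t := by
  induction t with
  | var x => simpa [Tm.lim] using he _ x
  | zero => exact .const e .zero (fun _ => rfl) (v := (0 : ℕ)) rfl
  | tt => exact .const e .tt (fun _ => rfl) (v := true) rfl
  | ff => exact .const e .ff (fun _ => rfl) (v := false) rfl
  | cond T => simpa [Tm.lim] using tracks_limCond T
  | recur T => simpa [Tm.lim] using tracks_limRecur T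
  | suc t ih => simpa [Tm.lim] using tracks_limSuc _ _ (ih e ε he)
  | app t u iht ihu => simpa [Tm.lim] using iht e ε he _ _ (ihu e ε he)
  | fst t ih => simpa [Tm.lim] using (ih e ε he).1
  | snd t ih => simpa [Tm.lim] using (ih e ε he).2
  | pair t u iht ihu =>
    refine ⟨?_, ?_⟩
    · simpa [Tm.lim] using iht e ε he
    · simpa [Tm.lim] using ihu e ε he
  | lam U t ih =>
    intro y β hy
    have := ih (e.cons y) (fun m => (ε m).cons (β m)) fun T x => by
      cases x with
      | here => exact hy
      | there x => exact he T x
    simpa [Tm.lim] using this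
  | data d => exact .const e (.data d) (fun _ => rfl) (v := ⟨d, rfl⟩) rfl
  | fn c =>
    let g : Cls S (.arr Ty.N (Ty.curried (S.args c) (S.res c))) := eval e (.lam Ty.N (.fn c))
    have hg : ∀ m, g.app (num m) = mk (.fn c) := fun m => by simp [g]
    -- The constant is a constant sequence of functions, so the identity modulus starts the
    -- accumulation; the reduction rules give its values.
    have := Tracks.limFn (g := g) (M := mk Tm.idModulus)
      (fun m v => ⟨.fn c, S.rule c v, hg m, mk_eq_mk.2 (.rule c v)⟩)
      (by simpa only [hg] using controls_idModulus _)
    simp only [hg] at this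
    simpa [Tm.lim, g] using this

theorem Cls.mk_app_eq_of_termLE {f g : Closed S.toSignature Ty.NN} (h : TermLE S f g) (i : ℕ) :
    (mk f).app (num i) = num 0 ∨ (mk f).app (num i) = (mk g).app (num i) := by
  obtain ⟨f', g', hf, hg, hfg⟩ := h
  have hf' : (mk f).app (num i) = num (f' i) := mk_eq_mk.2 (hf i)
  have hg' : (mk g).app (num i) = num (g' i) := mk_eq_mk.2 (hg i)
  rw [hf', hg']
  by_cases h0 : f' i = 0
  · exact .inl (by rw [h0])
  · exact .inr (by rw [hfg i h0])

/-- For fixed `i` and `z`, test `s (h z) i`. If it is `0`, so are all earlier values, and `z` begins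
a constant interval. Otherwise the value persists from `h z` onwards, and `h z` begins one.
`Tracks.collapse` then evaluates the chain at a convergent argument. -/
theorem tracks_limChain {s : Closed S.toSignature Ty.NNN} (hs : WeaklyIncreasing S s) :
    Tracks Ty.NN ((mk Tm.limChain).app (mk s)) fun m => (mk s).app (num m) := by
  intro x κ hx
  obtain ⟨k, rfl⟩ := hx.exists_num
  let g : Cls S (.arr Ty.N Ty.N.lim) := eval (Env.nil.cons (mk s))
    (.lam Ty.N (.pair (.lam Ty.N (.app (.app .v2 .v0) .v1))
      (.lam Ty.NN (.lam Ty.N (.app (.app (.app (.recur Ty.N) .v0)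
      (.lam Ty.N (.lam Ty.N (.app .v3 .v2)))) (.app (.app .v3 (.app .v1 .v0)) .v2))))))
  have hval : ∀ m i, ∃ v, ((mk s).app (num m)).app (num i) = num v := fun m i => by
    -- The reflexive instance of monotonicity says that `s m` represents a function at all.
    obtain ⟨f, -, hf, -⟩ := hs m m le_rfl
    exact ⟨f i, mk_eq_mk.2 (hf i)⟩
  have hle : ∀ m m' i, m ≤ m' → ((mk s).app (num m)).app (num i) = num 0 ∨
      ((mk s).app (num m)).app (num i) = ((mk s).app (num m')).app (num i) :=
    fun m m' i h => mk_app_eq_of_termLE (hs m m' h) i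
  have hg : ∀ i, Tracks Ty.N (g.app (num i)) fun m => ((mk s).app (num m)).app (num i) := by
    intro i
    refine ⟨fun m => by simp [g], fun m => hval m i, fun h hh z => ?_⟩
    obtain ⟨c, hc, hzc⟩ := hh z
    obtain ⟨v, hv⟩ := hval c i
    cases v with
    | zero =>
      have h0 : ∀ m b, h.app (num z) = num b → m ≤ b →
          ((mk s).app (num m)).app (num i) = num 0 := fun m b hb hm =>
        (hle m b i hm).elim id fun h => h.trans (by rw [← hb, hc, hv])
      exact ⟨z, le_rfl, by simp [g, hc, hv], fun b hb y hzy hyb =>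
        (h0 y b hb hyb).trans (h0 z b hb (hzy.trans hyb)).symm⟩
    | succ v =>
      refine ⟨c, hzc, by simp [g, hc, hv], fun b hb y hcy hyb => ?_⟩
      rcases hle c y i hcy with h' | h'
      -- Here a value is both `0` and a successor; instead of excluding this by consistency, the
      -- collapse of all equalities settles the case.
      · exact eq_of_num_eq (h'.symm.trans hv) _ _
      · exact h'.symm
  convert Tracks.collapse hg hx using 1
  rw [mk_eq_eval Tm.limChain]
  simp [Tm.limChain, g]

theorem Cls.mk_alongChain_app {A : Base S.Atom}
    (t : Closed S.toSignature (.arr Ty.N (.arr Ty.NN (.base A))))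
    (s : Closed S.toSignature Ty.NNN) (n m : ℕ) :
    (mk (alongChain t s n)).app (num m) =
      ((mk t).app (num n)).app ((mk s).app (num m)) := by
  have hn : ∀ (k : ℕ) (u : Closed S.toSignature Ty.N), Tm.inst (Tm.num k) u = Tm.num k := by
    intro k u
    induction k with
    | zero => rfl
    | succ k ih => exact congrArg Tm.suc ih
  refine (mk_eq_mk.2 (.beta _ _)).trans ?_
  change mk (.app (.app (t.weaken.inst _) ((Tm.num n).inst _)) (.app (s.weaken.inst _) _)) = _
  rw [Tm.inst_weaken, Tm.inst_weaken, hn]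
  rfl

theorem isModulus_modulus {A : Base S.Atom}
    (t : Closed S.toSignature (.arr Ty.N (.arr Ty.NN (.base A))))
    {s : Closed S.toSignature Ty.NNN} (hs : WeaklyIncreasing S s) (n : ℕ) :
    IsModulus S (.app (.app t.modulus (Tm.num n)) s) (alongChain t s n) := by
  have key := (tracks_lim t Env.nil (fun _ => Env.nil) (fun _ x => x.elim) _ _ (.constSeq n) _ _
    (tracks_limChain hs)).2.2
  have hM : mk (.app (.app t.modulus (Tm.num n)) s) = snd (((eval (Γ := []) Env.nil t.lim).app
      ((mk Tm.constSeq).app (num n))).app ((mk Tm.limChain).app (mk s))) := by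
    change ((mk t.modulus).app (num n)).app (mk s) = _
    rw [mk_eq_eval t.modulus, ← mk_eq_eval (Tm.lim t)]
    simp [Tm.modulus]
  rw [← hM] at key
  simp only [← mk_eq_eval, ← mk_alongChain_app] at key
  have hid : ∀ h : Closed S.toSignature Ty.NN, GeId S h → (mk h).GeId := fun h hh x => by
    obtain ⟨y, hy, hxy⟩ := hh x
    exact ⟨y, mk_eq_mk.2 hy, hxy⟩
  refine ⟨fun h hh z => ?_, fun h hh z => ?_⟩
  · obtain ⟨a, hza, ha, -⟩ := key _ (hid h hh) z
    exact ⟨a, mk_eq_mk.1 ha, hza⟩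
  · obtain ⟨a, hza, ha, hf⟩ := key _ (hid h hh) z
    obtain ⟨b, hb, -⟩ := hid h hh a
    refine ⟨a, b, mk_eq_mk.1 ha, mk_eq_mk.1 ?_, fun x hx hxb => mk_eq_mk.1 (hf b hb x hx hxb)⟩
    exact (congrArg (mk h).app ha).trans hb

end Tracking

/-! ### Recursion on Gödel numbers and computable formation rules -/

section Computability

theorem computable_natPair {α : Type*} [Primcodable α] {f g : α → ℕ} (hf : Computable f)
    (hg : Computable g) : Computable fun a => Nat.pair (f a) (g a) :=
  Primrec₂.natPair.to_comp.comp hf hg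

theorem computable_ite_eq {α : Type*} [Primcodable α] {k f g : α → ℕ} (c : ℕ) (hk : Computable k)
    (hf : Computable f) (hg : Computable g) :
    Computable fun a => if k a = c then f a else g a := by
  have hd : Computable fun n : ℕ => decide (n = c) :=
    (Primrec.eq.comp .id (.const c)).decide.to_comp
  refine (Computable.cond (hd.comp hk) hf hg).of_eq fun a => ?_
  by_cases h : k a = c <;> simp [h]

/-- Computable functions can be defined by recursion on the components of tagged pairs. -/
theorem exists_computable_rec {G : ℕ → ℕ → ℕ → ℕ → ℕ → ℕ}
    (hG : Computable fun p : ℕ × ℕ × ℕ × ℕ × ℕ => G p.1 p.2.1 p.2.2.1 p.2.2.2.1 p.2.2.2.2) :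
    ∃ f : ℕ → ℕ, Computable f ∧ ∀ k x, 0 < k →
      f (Nat.pair k x) = G k x (f x) (f x.unpair.1) (f x.unpair.2) := by
  let step : ℕ → List ℕ → ℕ := fun n l => G n.unpair.1 n.unpair.2 (l[n.unpair.2]?.getD 0)
    (l[n.unpair.2.unpair.1]?.getD 0) (l[n.unpair.2.unpair.2]?.getD 0)
  have hstep : Computable₂ step := by
    have h1 : Computable fun p : ℕ × List ℕ => p.1.unpair.1 :=
      Computable.fst.comp (Computable.unpair.comp .fst)
    have h2 : Computable fun p : ℕ × List ℕ => p.1.unpair.2 :=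
      Computable.snd.comp (Computable.unpair.comp .fst)
    have hget : ∀ {i : ℕ × List ℕ → ℕ}, Computable i →
        Computable fun p => (p.2[i p]?.getD 0 : ℕ) := fun hi =>
      Computable.option_getD (Computable.list_getElem?.comp .snd hi) (.const 0)
    have hall := h1.pair (h2.pair ((hget h2).pair
      ((hget (Computable.fst.comp (Computable.unpair.comp h2))).pair
        (hget (Computable.snd.comp (Computable.unpair.comp h2))))))
    have := hG.comp hall
    exact this
  -- `tab n` lists the values at all numbers below `n`, so a course-of-values recursion becomes a
  -- primitive one. The default `0` in `step` is returned only for lookups outside the table.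
  let tab : ℕ → List ℕ := fun n => Nat.rec [] (fun n l => l ++ [step n l]) n
  have htab : Computable tab := by
    have h2 : Computable fun p : ℕ × ℕ × List ℕ => p.2.2 := Computable.snd.comp .snd
    exact Computable.nat_rec .id (.const [])
      (Computable.list_concat.comp h2 (hstep.comp (Computable.fst.comp .snd) h2)).to₂
  have hlen : ∀ n, (tab n).length = n := by
    intro n
    induction n with
    | zero => rfl
    | succ n ih =>
      change (tab n ++ [_]).length = _
      simp [ih]
  have hget : ∀ n i, i < n → (tab n)[i]? = some (step i (tab i)) := by
    intro n
    induction n with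
    | zero => simp
    | succ n ih =>
      intro i hi
      change (tab n ++ [_])[i]? = _
      rcases Nat.lt_succ_iff_lt_or_eq.1 hi with hi | rfl
      · rw [List.getElem?_append_left (by rwa [hlen]), ih i hi]
      · rw [List.getElem?_append_right (by rw [hlen]), hlen]
        simp [tab]
  have hf : Computable fun n => step n (tab n) := hstep.comp .id htab
  refine ⟨fun n => step n (tab n), hf, fun k x hk => ?_⟩
  -- Positivity of the tag makes the content, and hence its two components, strictly smaller than
  -- the code.
  have hlt : x < Nat.pair k x := by
    unfold Nat.pair
    split <;> nlinarith
  have h1 := (Nat.unpair_left_le x).trans_lt hlt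
  have h2 := (Nat.unpair_right_le x).trans_lt hlt
  simp only [step, Nat.unpair_pair, hget _ _ hlt, hget _ _ h1, hget _ _ h2, Option.getD_some]

attribute [local irreducible] Nat.pair

namespace Code

/-! Arithmetical counterparts of the formation rules for types and terms. -/

def N : ℕ := Nat.pair 1 0

def arr (u v : ℕ) : ℕ := Nat.pair 4 (Nat.pair u v)

def prod (u v : ℕ) : ℕ := Nat.pair 5 (Nat.pair u v)

def NN : ℕ := arr N N

def Modulus : ℕ := arr NN NN

def limBase (A : ℕ) : ℕ := prod (arr N A) Modulus

def var (i : ℕ) : ℕ := Nat.pair 1 i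

def zero : ℕ := Nat.pair 2 0

def cond (T : ℕ) : ℕ := Nat.pair 5 T

def recur (T : ℕ) : ℕ := Nat.pair 6 T

def suc (t : ℕ) : ℕ := Nat.pair 7 t

def app (t u : ℕ) : ℕ := Nat.pair 8 (Nat.pair t u)

def fst (t : ℕ) : ℕ := Nat.pair 9 t

def snd (t : ℕ) : ℕ := Nat.pair 10 t

def pair (t u : ℕ) : ℕ := Nat.pair 11 (Nat.pair t u)

def lam (u t : ℕ) : ℕ := Nat.pair 12 (Nat.pair u t)

def collapseBase (T : ℕ) : ℕ :=
  lam (arr N T) (lam (limBase N) (pair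
    (lam N (app (fst (app (var 2) (app (fst (var 1)) (var 0)))) (var 0)))
    (lam NN (lam N (app
      (lam N (app (app (snd (app (var 4) (app (fst (var 3)) (var 0)))) (var 2)) (var 0)))
      (app (app (snd (var 2)) (lam N (app (var 2)
        (app (app (snd (app (var 4) (app (fst (var 3)) (var 0)))) (var 2)) (var 0))))) (var 0)))))))

def collapseArr (T U t : ℕ) : ℕ :=
  lam (arr N T) (lam (limBase N) (lam U
    (app (app t (lam N (app (app (var 3) (var 0)) (var 1)))) (var 1))))

def collapseProd (T t u : ℕ) : ℕ :=
  lam (arr N T) (lam (limBase N) (pair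
    (app (app t (lam N (fst (app (var 2) (var 0))))) (var 0))
    (app (app u (lam N (snd (app (var 2) (var 0))))) (var 0))))

def limRecur (c T t : ℕ) : ℕ :=
  lam T (lam (arr (limBase N) (arr T T)) (app t
    (app (app (recur T) (var 1)) (lam N (app (var 1) (app c (var 0)))))))

def limCond (B T t : ℕ) : ℕ :=
  lam B (lam T (lam T (app
    (app t (app (app (recur T) (var 1)) (lam N (lam T (var 2)))))
    (pair (lam N (app (app (app (cond N) (app (fst (var 3)) (var 0))) zero) (suc zero)))
      (snd (var 2))))))

def limFnNil (A : ℕ) : ℕ := lam (arr N A) (lam Modulus (pair (var 1) (var 0)))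

def limFnCons (j A A' T T' : ℕ) : ℕ :=
  lam (arr (arr N T) (arr Modulus T')) (lam (arr N (arr A T)) (lam Modulus (lam A'
    (app (app (var 3) (lam N (app (app (var 3) (var 0)) (app (fst (var 1)) (var 0)))))
      (app (app j (var 1)) (snd (var 0)))))))

def modulus (c s t : ℕ) : ℕ :=
  lam N (lam (arr N NN) (snd (app (app t (app c (var 1))) (app s (var 0)))))

section Formers

variable {α : Type*} [Primcodable α] {f g h k l : α → ℕ}

theorem computable_arr (hf : Computable f) (hg : Computable g) :
    Computable fun a => arr (f a) (g a) :=
  computable_natPair (.const _) (computable_natPair hf hg)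

theorem computable_prod (hf : Computable f) (hg : Computable g) :
    Computable fun a => prod (f a) (g a) :=
  computable_natPair (.const _) (computable_natPair hf hg)

theorem computable_app (hf : Computable f) (hg : Computable g) :
    Computable fun a => app (f a) (g a) :=
  computable_natPair (.const _) (computable_natPair hf hg)

theorem computable_pair (hf : Computable f) (hg : Computable g) :
    Computable fun a => pair (f a) (g a) :=
  computable_natPair (.const _) (computable_natPair hf hg)

theorem computable_lam (hf : Computable f) (hg : Computable g) :
    Computable fun a => lam (f a) (g a) :=
  computable_natPair (.const _) (computable_natPair hf hg)

theorem computable_fst (hf : Computable f) : Computable fun a => fst (f a) :=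
  computable_natPair (.const _) hf

theorem computable_snd (hf : Computable f) : Computable fun a => snd (f a) :=
  computable_natPair (.const _) hf

theorem computable_recur (hf : Computable f) : Computable fun a => recur (f a) :=
  computable_natPair (.const _) hf

theorem computable_limBase (hf : Computable f) : Computable fun a => limBase (f a) :=
  computable_prod (computable_arr (.const _) hf) (.const _)

theorem computable_collapseBase (hf : Computable f) :
    Computable fun a => collapseBase (f a) := by
  unfold collapseBase
  repeat' with_reducible first
    | assumption | exact Computable.const _ | apply computable_app | apply computable_lam
    | apply computable_arr

theorem computable_collapseArr (hf : Computable f) (hg : Computable g) (hh : Computable h) :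
    Computable fun a => collapseArr (f a) (g a) (h a) := by
  unfold collapseArr
  repeat' with_reducible first
    | assumption | exact Computable.const _ | apply computable_app | apply computable_lam
    | apply computable_arr

theorem computable_collapseProd (hf : Computable f) (hg : Computable g) (hh : Computable h) :
    Computable fun a => collapseProd (f a) (g a) (h a) := by
  unfold collapseProd
  repeat' with_reducible first
    | assumption | exact Computable.const _ | apply computable_app | apply computable_lam
    | apply computable_arr | apply computable_fst | apply computable_snd | apply computable_pair

theorem computable_limRecur (hf : Computable f) (hg : Computable g) (hh : Computable h) :
    Computable fun a => limRecur (f a) (g a) (h a) := by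
  unfold limRecur
  repeat' with_reducible first
    | assumption | exact Computable.const _ | apply computable_app | apply computable_lam
    | apply computable_arr | apply computable_recur

theorem computable_limCond (hf : Computable f) (hg : Computable g) (hh : Computable h) :
    Computable fun a => limCond (f a) (g a) (h a) := by
  unfold limCond
  repeat' with_reducible first
    | assumption | exact Computable.const _ | apply computable_app | apply computable_lam
    | apply computable_fst | apply computable_snd | apply computable_pair | apply computable_recur

theorem computable_limFnNil (hf : Computable f) :
    Computable fun a => limFnNil (f a) := by
  unfold limFnNil
  repeat' with_reducible first
    | assumption | exact Computable.const _ | apply computable_lam | apply computable_arr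

theorem computable_limFnCons (hf : Computable f) (hg : Computable g) (hh : Computable h)
    (hk : Computable k) (hl : Computable l) :
    Computable fun a => limFnCons (f a) (g a) (h a) (k a) (l a) := by
  unfold limFnCons
  repeat' with_reducible first
    | assumption | exact Computable.const _ | apply computable_app | apply computable_lam
    | apply computable_arr

theorem computable_modulus (hf : Computable f) (hg : Computable g) (hh : Computable h) :
    Computable fun a => modulus (f a) (g a) (h a) := by
  unfold modulus
  repeat' with_reducible first
    | assumption | exact Computable.const _ | apply computable_app | apply computable_lam
    | apply computable_snd

end Formers

end Code

/-! ### Effectiveness of the translation -/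

/-- Computability of the data available in a recursion step. -/
theorem computable_components :
    (Computable fun p : ℕ × ℕ × ℕ × ℕ × ℕ => p.2.1) ∧
    (Computable fun p : ℕ × ℕ × ℕ × ℕ × ℕ => p.2.2.1) ∧
    (Computable fun p : ℕ × ℕ × ℕ × ℕ × ℕ => p.2.2.2.1) ∧
    Computable fun p : ℕ × ℕ × ℕ × ℕ × ℕ => p.2.2.2.2 :=
  ⟨Computable.fst.comp .snd, Computable.fst.comp (Computable.snd.comp .snd),
    Computable.fst.comp (Computable.snd.comp (Computable.snd.comp .snd)),
    Computable.snd.comp (Computable.snd.comp (Computable.snd.comp .snd))⟩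

theorem exists_code_tyLim (α : Type) [Encodable α] :
    ∃ f : ℕ → ℕ, Computable f ∧ ∀ T : Ty α, f T.code = T.lim.code := by
  obtain ⟨f, hf, h⟩ := exists_computable_rec (G := fun k x _ l r =>
    if k = 4 then Code.arr l r else
    if k = 5 then Code.prod l r else Code.limBase (Nat.pair k x)) (by
      obtain ⟨hx, -, hl, hr⟩ := computable_components
      exact computable_ite_eq 4 .fst (Code.computable_arr hl hr) <|
        computable_ite_eq 5 .fst (Code.computable_prod hl hr) <|
        Code.computable_limBase (computable_natPair .fst hx))
  refine ⟨f, hf, fun T => ?_⟩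
  induction T with
  | base A =>
    cases A <;> simp [Ty.code, h, Code.limBase, Code.prod, Code.arr, Code.N, Code.Modulus, Code.NN]
  | arr U V ihU ihV => simp [Ty.code, h, ihU, ihV, Code.arr]
  | prod U V ihU ihV => simp [Ty.code, h, ihU, ihV, Code.prod]

theorem exists_code_collapse (S : Signature) :
    ∃ f : ℕ → ℕ, Computable f ∧ ∀ T : Ty S.Atom, f T.code = (Tm.collapse T).code := by
  obtain ⟨L, hL, hLc⟩ := exists_code_tyLim S.Atom
  obtain ⟨f, hf, h⟩ := exists_computable_rec (G := fun k x _ l r =>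
    if k = 4 then Code.collapseArr (L (Nat.pair k x)) (L x.unpair.1) r else
    if k = 5 then Code.collapseProd (L (Nat.pair k x)) l r else
      Code.collapseBase (L (Nat.pair k x))) (by
      obtain ⟨hx, -, hl, hr⟩ := computable_components
      have hLn := hL.comp (computable_natPair .fst hx)
      exact computable_ite_eq 4 .fst (Code.computable_collapseArr hLn
          (hL.comp (Computable.fst.comp (Computable.unpair.comp hx))) hr) <|
        computable_ite_eq 5 .fst (Code.computable_collapseProd hLn hl hr) <|
        Code.computable_collapseBase hLn)
  refine ⟨f, hf, fun T => ?_⟩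
  induction T with
  | base A =>
    have : f (Ty.base A).code = Code.collapseBase (Ty.base A).lim.code := by
      rw [← hLc]
      cases A <;> simp [Ty.code, h]
    rw [this]
    simp only [Tm.collapse, Tm.code, Var.index, Ty.code, Code.collapseBase, Code.limBase, Code.N,
      Code.NN, Code.Modulus, Code.prod, Code.arr, Code.var, Code.app, Code.fst, Code.snd, Code.pair,
      Code.lam, Nat.reduceAdd]
  | arr U V ihU ihV =>
    have : f (Ty.arr U V).code =
        Code.collapseArr (Ty.arr U V).lim.code U.lim.code (Tm.collapse V).code := by
      rw [← hLc, ← hLc, ← ihV]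
      simp [Ty.code, h]
    rw [this]
    simp only [Tm.collapse, Tm.code, Tm.code_cl, Var.index, Ty.code, Code.collapseArr, Code.limBase,
      Code.N, Code.NN, Code.Modulus, Code.prod, Code.arr, Code.var, Code.app, Code.lam,
      Nat.reduceAdd]
  | prod U V ihU ihV =>
    have : f (Ty.prod U V).code = Code.collapseProd (Ty.prod U V).lim.code (Tm.collapse U).code
        (Tm.collapse V).code := by
      rw [← hLc, ← ihU, ← ihV]
      simp [Ty.code, h]
    rw [this]
    simp only [Tm.collapse, Tm.code, Tm.code_cl, Var.index, Ty.code, Code.collapseProd,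
      Code.limBase, Code.N, Code.NN, Code.Modulus, Code.prod, Code.arr, Code.var, Code.app,
      Code.fst, Code.snd, Code.pair, Code.lam, Nat.reduceAdd]

/-- The recursion runs on the code of the function type: an arrow tag means one more argument, any
other tag the atomic result. The code of the type thus suffices to recover the argument list. -/
theorem exists_code_limFn (S : Signature) :
    ∃ f : ℕ → ℕ, Computable f ∧ ∀ (A : Base S.Atom) (As : List (Base S.Atom)),
      f (Ty.curried As A).code = (Tm.limFn A As).code := by
  obtain ⟨L, hL, hLc⟩ := exists_code_tyLim S.Atom
  obtain ⟨f, hf, h⟩ := exists_computable_rec (G := fun k x _ _ r =>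
    if k = 4 then Code.app (Code.limFnCons (Tm.joinModulus (S := S)).code x.unpair.1
      (L x.unpair.1) x.unpair.2 (L x.unpair.2)) r else Code.limFnNil (Nat.pair k x)) (by
      obtain ⟨hx, -, -, hr⟩ := computable_components
      have h1 := Computable.fst.comp (Computable.unpair.comp hx)
      have h2 := Computable.snd.comp (Computable.unpair.comp hx)
      exact computable_ite_eq 4 .fst (Code.computable_app
          (Code.computable_limFnCons (.const _) h1 (hL.comp h1) h2 (hL.comp h2)) hr) <|
        Code.computable_limFnNil (computable_natPair .fst hx))
  refine ⟨f, hf, fun A As => ?_⟩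
  induction As with
  | nil =>
    have : f (Ty.base A).code = Code.limFnNil (Ty.base A).code := by
      cases A <;> simp [Ty.code, h]
    refine this.trans ?_
    simp only [Tm.limFn, Tm.limFnNil, Tm.code, Var.index, Ty.code, Code.limFnNil, Code.N, Code.NN,
      Code.Modulus, Code.arr, Code.var, Code.pair, Code.lam, Nat.reduceAdd]
  | cons B Bs ih =>
    have : f (Ty.curried (B :: Bs) A).code = Code.app (Code.limFnCons
        (Tm.joinModulus (S := S)).code (Ty.base B).code (Ty.base B).lim.code (Ty.curried Bs A).code
        (Ty.curried Bs A).lim.code) (Tm.limFn A Bs).code := by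
      rw [← ih, ← hLc, ← hLc, Ty.curried, Ty.code, h _ _ (by norm_num)]
      simp
    rw [this]
    simp only [Tm.limFn, Tm.limFnCons, Tm.code, Tm.code_cl, Var.index, Ty.code, Code.limFnCons,
      Code.N, Code.NN, Code.Modulus, Code.arr, Code.var, Code.app, Code.fst, Code.snd, Code.lam,
      Nat.reduceAdd]

/-- Recursiveness of the type assignment enters here; numbers that code no constant are sent to `0`.
-/
theorem exists_code_fnTy (S : Signature) :
    ∃ f : ℕ → ℕ, Computable f ∧
      ∀ c : S.Fn, f (Encodable.encode c) = (Ty.curried (S.args c) (S.res c)).code :=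
  ⟨fun n => ((Encodable.decode n : Option S.Fn).map fun c =>
      (Ty.curried (S.args c) (S.res c)).code).getD 0,
    Computable.option_getD (Computable.option_map Computable.decode
      (S.computable_fnTy.comp .snd)) (.const 0),
    fun c => by simp⟩

/-- Binders, recursors and conditionals carry their types in the code, and the type of a function
constant is computable from it. So each clause of the translation can be carried out without knowing
the context or type of the term. -/
theorem exists_code_tmLim (S : Signature) :
    ∃ f : ℕ → ℕ, Computable f ∧ ∀ {Γ : List (Ty S.Atom)} {T : Ty S.Atom} (t : Tm S Γ T),
      f t.code = t.lim.code := by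
  obtain ⟨L, hL, hLc⟩ := exists_code_tyLim S.Atom
  obtain ⟨K, hK, hKc⟩ := exists_code_collapse S
  obtain ⟨H, hH, hHc⟩ := exists_code_limFn S
  obtain ⟨τ, hτ, hτc⟩ := exists_code_fnTy S
  let B : ℕ := (Ty.B (α := S.Atom)).lim.code
  let i : ℕ := (Tm.idModulus (S := S)).code
  let c : ℕ := (Tm.constSeq (S := S)).code
  let s : ℕ := (Tm.limSuc (S := S)).code
  obtain ⟨f, hf, h⟩ := exists_computable_rec (G := fun k x y l r =>
    if k = 1 then Code.var x else
    if k = 5 then Code.limCond B (L x) (K x) else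
    if k = 6 then Code.limRecur c (L x) (K x) else
    if k = 7 then Code.app s y else
    if k = 8 then Code.app l r else
    if k = 9 then Code.fst y else
    if k = 10 then Code.snd y else
    if k = 11 then Code.pair l r else
    if k = 12 then Code.lam (L x.unpair.1) r else
    -- A constant is its own code `Nat.pair k x`, which reappears as the body of its constant
    -- sequence. The final default serves the tags of `0`, the booleans and the atomic data.
    if k = 14 then Code.app (Code.app (H (τ x)) (Code.lam Code.N (Nat.pair k x))) i else
      Code.pair (Code.lam Code.N (Nat.pair k x)) i) (by
      obtain ⟨hx, hy, hl, hr⟩ := computable_components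
      have hn := Code.computable_lam (.const Code.N) (computable_natPair .fst hx)
      exact computable_ite_eq 1 .fst (computable_natPair (.const 1) hx) <|
        computable_ite_eq 5 .fst (Code.computable_limCond (.const B) (hL.comp hx) (hK.comp hx)) <|
        computable_ite_eq 6 .fst (Code.computable_limRecur (.const c) (hL.comp hx) (hK.comp hx)) <|
        computable_ite_eq 7 .fst (Code.computable_app (.const s) hy) <|
        computable_ite_eq 8 .fst (Code.computable_app hl hr) <|
        computable_ite_eq 9 .fst (Code.computable_fst hy) <|
        computable_ite_eq 10 .fst (Code.computable_snd hy) <|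
        computable_ite_eq 11 .fst (Code.computable_pair hl hr) <|
        computable_ite_eq 12 .fst (Code.computable_lam
          (hL.comp (Computable.fst.comp (Computable.unpair.comp hx))) hr) <|
        computable_ite_eq 14 .fst (Code.computable_app
          (Code.computable_app (hH.comp (hτ.comp hx)) hn) (.const i)) <|
        Code.computable_pair hn (.const i))
  refine ⟨f, hf, fun t => ?_⟩
  induction t with
  | var x => simp [Tm.code, Tm.lim, h, Code.var, Var.index_lim]
  | cond T =>
    have : f (Tm.code (S := S) (Γ := []) (.cond T)) =
        Code.limCond B T.lim.code (Tm.collapse T).code := by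
      simp [Tm.code, h, hLc, hKc]
    refine this.trans ?_
    simp only [Tm.lim, Tm.limCond, Tm.code, Tm.code_cl, Var.index, Ty.code, Code.limCond, Code.N,
      Code.cond, Code.recur, Code.zero, Code.suc, Code.var, Code.app, Code.fst, Code.snd, Code.pair,
      Code.lam, Nat.reduceAdd, B]
  | recur T =>
    have : f (Tm.code (S := S) (Γ := []) (.recur T)) =
        Code.limRecur c T.lim.code (Tm.collapse T).code := by
      simp [Tm.code, h, hLc, hKc]
    refine this.trans ?_
    simp only [Tm.lim, Tm.limRecur, Tm.code, Tm.code_cl, Var.index, Ty.code, Code.limRecur, Code.N,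
      Code.NN, Code.Modulus, Code.limBase, Code.prod, Code.arr, Code.recur, Code.var, Code.app,
      Code.lam, Nat.reduceAdd, c]
  | lam U t ih => simp [Tm.code, Tm.lim, h, hLc, ih, Code.lam]
  | fn a => simp [Tm.code, Tm.lim, h, hτc, hHc, Code.app, Code.lam, Code.N, Ty.code, i]
  | zero | tt | ff | data d => simp [Tm.code, Tm.lim, h, Code.pair, Code.lam, Code.N, Ty.code, i]
  | suc t ih => simp [Tm.code, Tm.lim, h, ih, Code.app, s]
  | app t u iht ihu => simp [Tm.code, Tm.lim, h, iht, ihu, Code.app]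
  | fst t ih => simp [Tm.code, Tm.lim, h, ih, Code.fst]
  | snd t ih => simp [Tm.code, Tm.lim, h, ih, Code.snd]
  | pair t u iht ihu => simp [Tm.code, Tm.lim, h, iht, ihu, Code.pair]

theorem exists_code_modulus (S : Signature) :
    ∃ f : ℕ → ℕ, Computable f ∧ ∀ {A : Base S.Atom}
      (t : Closed S (.arr Ty.N (.arr Ty.NN (.base A)))), f t.code = t.modulus.code := by
  obtain ⟨f, hf, h⟩ := exists_code_tmLim S
  refine ⟨fun n => Code.modulus (Tm.constSeq (S := S)).code (Tm.limChain (S := S)).code (f n),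
    Code.computable_modulus (.const _) (.const _) hf, fun t => ?_⟩
  have ht : Tm.code (Γ := [Ty.NNN, Ty.N]) (Tm.cl t.lim) = f t.code :=
    (Tm.code_cl _).trans (h t).symm
  simp only [Tm.modulus, Tm.code, Tm.code_cl, ht, Var.index, Ty.code, Code.modulus, Code.N, Code.NN,
    Code.arr, Code.var, Code.app, Code.snd, Code.lam, Nat.reduceAdd]

end Computability

end SysT

/-- There is a computable function which, on Gödel numbers, takes every closed term
`t : N → (N → N) → A` with `A` atomic to a closed term `M` such that `M n s` is a modulus of
convergence for `λ m. t n (s m)`, for all weakly increasing `s` and all `n`. -/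
theorem mainTheorem4 (S : SysT.SimpleExtension) :
    ∃ F : ℕ → ℕ, Computable F ∧
      ∀ (A : SysT.Base S.Atom)
        (t : SysT.Closed S.toSignature (.arr .N (.arr .NN (.base A)))),
        ∃ M : SysT.Closed S.toSignature (.arr .N (.arr .NNN (.arr .NN .NN))),
          F t.code = M.code ∧
          ∀ s : SysT.Closed S.toSignature .NNN, SysT.WeaklyIncreasing S s → ∀ n : ℕ,
            SysT.IsModulus S (.app (.app M (SysT.Tm.num n)) s) (SysT.alongChain t s n) := by
  obtain ⟨F, hF, h⟩ := SysT.exists_code_modulus S.toSignature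
  exact ⟨F, hF, fun A t => ⟨t.modulus, h t, fun s hs n => SysT.isModulus_modulus t hs n⟩⟩
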